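/- Throughout, a finite (directed) graph has finitely many vertices and edges; loops and parallel edges are allowed. A vertex is a sink if it emits no edge, a source if it receives no edge, and regular if it is not a sink. A graph is totally looped if every regular vertex is the base of at least one loop. Eliminating a source $v$ means deleting $v$ together with all edges that $v$ emits (isolated vertices may be eliminated too). Collapsing a graph at a regular vertex $v$ that is not the base of a loop means deleting $v$ and all edges that $v$ receives or emits, and adding, for every edge $e$ with range $v$ and every edge $f$ with source $v$, a new edge $[ef]$ from the source of $e$ to the range of $f$. For a nonempty finite graph $E$, $E_{sf}$ denotes the subgraph of $E$ that is left when sources are eliminated one after another until no source remains; if $E$ is acyclic, so that this would end in the empty graph, one stops at the last one-vertex graph without edges instead. ($E_{sf}$ does not depend on the order of the eliminations, except, for acyclic $E$, for the choice of the sink of $E$ that is its only vertex; the statement holds for every such choice.) $L_K(E)$ is the Leavitt path algebra of $E$ with coefficients in $K$: the $K$-algebra generated by the vertices $v$, the edges $e$ and symbols $e^*$, subject to $vw=\delta_{v,w}v$; $s(e)e=e=e\,r(e)$ and $r(e)e^*=e^*=e^*s(e)$; $e^*f=\delta_{e,f}r(e)$; and $v=\sum_{s(e)=v}ee^*$ for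 every regular vertex $v$. It is unital, with $1=\sum_v v$. **Theorem.** Let $K$ be a field and let $E$ be a nonempty finite graph. Let $k$ be the number of vertices of $E$ that are sinks in $E$ but are not vertices of $E_{sf}$. Let $F$ be any totally looped graph obtained from $E_{sf}$ by finitely many (possibly no) successive collapses, each at a regular vertex that is not the base of a loop. Then $L_K(E)$ is Morita equivalent to $K^k\oplus L_K(F)$; in fact their categories of left modules are equivalent as $K$-linear categories. Consequently, there are positive integers $m_1,\dots,m_k$ and $n$ and a full idempotent $p\in M_n(L_K(F))$ (that is, $p^2=p$ and $M_n(L_K(F))\,p\,M_n(L_K(F))=M_n(L_K(F))$) such that $$L_K(E)\;\cong\;M_{m_1}(K)\oplus\cdots\oplus M_{m_k}(K)\oplus p\,M_n(L_K(F))\,p$$ as $K$-algebras. -/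

import Mathlib

universe u v w

/-- A finite directed graph, with parallel edges and loops allowed: a finite type `V` of vertices,
a finite type `E` of edges, and the source and range maps. -/
structure FinGraph where
  V : Type u
  E : Type v
  [finV : Finite V]
  [finE : Finite E]
  s : E → V
  r : E → V

namespace FinGraph

attribute [instance] FinGraph.finV FinGraph.finE

/-- A sink: a vertex that emits no edge. -/
def IsSink (G : FinGraph.{u, v}) (x : G.V) : Prop := ∀ e : G.E, G.s e ≠ x

/-- A regular vertex (of a finite graph): a vertex that is not a sink. -/
def IsRegular (G : FinGraph.{u, v}) (x : G.V) : Prop := ¬ G.IsSink x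

/-- There is a loop based at `x`. -/
def IsBaseOfLoop (G : FinGraph.{u, v}) (x : G.V) : Prop := ∃ e : G.E, G.s e = x ∧ G.r e = x

/-- Every regular vertex is the base of at least one loop. -/
def IsTotallyLooped (G : FinGraph.{u, v}) : Prop := ∀ x : G.V, G.IsRegular x → G.IsBaseOfLoop x

/-- Isomorphisms of directed graphs. -/
structure Iso (G H : FinGraph.{u, v}) where
  onV : G.V ≃ H.V
  onE : G.E ≃ H.E
  s_comm : ∀ e, H.s (onE e) = onV (G.s e)
  r_comm : ∀ e, H.r (onE e) = onV (G.r e)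

/-- Subgraphs of `G`. -/
@[ext]
structure Subgraph (G : FinGraph.{u, v}) where
  verts : Set G.V
  edges : Set G.E
  s_mem : ∀ e ∈ edges, G.s e ∈ verts
  r_mem : ∀ e ∈ edges, G.r e ∈ verts

namespace Subgraph

/-- The whole graph, as a subgraph of itself. -/
def whole (G : FinGraph.{u, v}) : G.Subgraph where
  verts := Set.univ
  edges := Set.univ
  s_mem _ _ := trivial
  r_mem _ _ := trivial

/-- A subgraph, as a graph in its own right. -/
def toGraph {G : FinGraph.{u, v}} (H : G.Subgraph) : FinGraph.{u, v} where
  V := {x : G.V // x ∈ H.verts}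
  E := {e : G.E // e ∈ H.edges}
  s e := ⟨G.s e.1, H.s_mem e.1 e.2⟩
  r e := ⟨G.r e.1, H.r_mem e.1 e.2⟩

/-- `x` is a source of the graph `H`: a vertex of `H` that receives no edge of `H`. -/
def IsSource {G : FinGraph.{u, v}} (H : G.Subgraph) (x : G.V) : Prop :=
  x ∈ H.verts ∧ ∀ e ∈ H.edges, G.r e ≠ x

/-- `H'` is the source elimination graph of `H` at some source `x` of `H`: the vertex `x` and all
the edges that it emits are deleted. Isolated vertices may be eliminated. -/
def SourceElim {G : FinGraph.{u, v}} (H H' : G.Subgraph) : Prop :=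
  ∃ x : G.V, H.IsSource x ∧ H'.verts = H.verts \ {x} ∧ H'.edges = H.edges \ {e | G.s e = x}

/-- The graph `H` has one vertex and no edges. -/
def IsTrivial {G : FinGraph.{u, v}} (H : G.Subgraph) : Prop :=
  (∃ x, H.verts = {x}) ∧ H.edges = ∅

/-- The graph `H` is nonempty and has no sources. -/
def IsSourceFree {G : FinGraph.{u, v}} (H : G.Subgraph) : Prop :=
  H.verts.Nonempty ∧ ∀ x, ¬ H.IsSource x

/-- `H` is an outcome `G_sf` of step-by-step source elimination, started at `G` and carried out
until no source is left; as the empty graph is avoided, the process also ends, for acyclic `G`,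
with the one-vertex graph that is reached just before the empty graph. -/
def IsSf {G : FinGraph.{u, v}} (H : G.Subgraph) : Prop :=
  Relation.ReflTransGen SourceElim (whole G) H ∧ (H.IsSourceFree ∨ H.IsTrivial)

end Subgraph

/-- The collapse of `G` at a vertex `x` that is not the base of a loop: `x` is deleted with all
the edges that it receives or emits, and for each `e` with range `x` and each `f` with source `x`
there is a new edge `[ef]` from `s e` to `r f`. -/
def collapse (G : FinGraph.{u, v}) (x : G.V) (hx : ¬ G.IsBaseOfLoop x) : FinGraph.{u, v} where
  V := {y : G.V // y ≠ x}
  E := {e : G.E // G.s e ≠ x ∧ G.r e ≠ x} ⊕ ({e : G.E // G.r e = x} × {f : G.E // G.s f = x})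
  s := Sum.elim (fun e => ⟨G.s e.1, e.2.1⟩)
    (fun p => ⟨G.s p.1.1, fun h => hx ⟨p.1.1, h, p.1.2⟩⟩)
  r := Sum.elim (fun e => ⟨G.r e.1, e.2.2⟩)
    (fun p => ⟨G.r p.2.1, fun h => hx ⟨p.2.1, p.2.2, h⟩⟩)

/-- `CollapsesTo G F`: up to isomorphism, `F` is obtained from `G` by finitely many (possibly no)
successive collapses, each of them at a regular vertex that is not the base of a loop. -/
inductive CollapsesTo : FinGraph.{u, v} → FinGraph.{u, v} → Prop
  | of_iso {G F : FinGraph.{u, v}} (φ : Iso G F) : CollapsesTo G F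
  | collapse {G F : FinGraph.{u, v}} (x : G.V) (hreg : G.IsRegular x)
      (hloop : ¬ G.IsBaseOfLoop x) (h : CollapsesTo (G.collapse x hloop) F) : CollapsesTo G F

/-- The generators of the Leavitt path algebra: vertices, edges `e` and ghost edges `e*`. -/
inductive LeavittGen (G : FinGraph.{u, v}) : Type (max u v)
  | vert (x : G.V) : LeavittGen G
  | edge (e : G.E) : LeavittGen G
  | ghost (e : G.E) : LeavittGen G

section Leavitt

variable (K : Type w) [Field K] (G : FinGraph.{u, v})

/-- The vertex `x` in the free algebra. -/
noncomputable def fv (x : G.V) : FreeAlgebra K G.LeavittGen := FreeAlgebra.ι K (.vert x)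

/-- The edge `e` in the free algebra. -/
noncomputable def fe (e : G.E) : FreeAlgebra K G.LeavittGen := FreeAlgebra.ι K (.edge e)

/-- The ghost edge `e*` in the free algebra. -/
noncomputable def fg (e : G.E) : FreeAlgebra K G.LeavittGen := FreeAlgebra.ι K (.ghost e)

/-- The defining relations of the Leavitt path algebra of a finite graph. The last one says that
the sum of the vertices, which is an identity element of the (non-unital) algebra presented by
the other relations, is the `1` of the free unital algebra. -/
inductive LeavittRel : FreeAlgebra K G.LeavittGen → FreeAlgebra K G.LeavittGen → Prop
  | vert_mul_self (x : G.V) : LeavittRel (fv K G x * fv K G x) (fv K G x)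
  | vert_mul_ne (x y : G.V) (h : x ≠ y) : LeavittRel (fv K G x * fv K G y) 0
  | source_mul_edge (e : G.E) : LeavittRel (fv K G (G.s e) * fe K G e) (fe K G e)
  | edge_mul_range (e : G.E) : LeavittRel (fe K G e * fv K G (G.r e)) (fe K G e)
  | range_mul_ghost (e : G.E) : LeavittRel (fv K G (G.r e) * fg K G e) (fg K G e)
  | ghost_mul_source (e : G.E) : LeavittRel (fg K G e * fv K G (G.s e)) (fg K G e)
  | ghost_mul_self (e : G.E) : LeavittRel (fg K G e * fe K G e) (fv K G (G.r e))
  | ghost_mul_ne (e f : G.E) (h : e ≠ f) : LeavittRel (fg K G e * fe K G f) 0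
  | vert_eq_sum (x : G.V) (h : G.IsRegular x) :
      LeavittRel (fv K G x) (∑ᶠ e : {e : G.E // G.s e = x}, fe K G e.1 * fg K G e.1)
  | sum_vert : LeavittRel (∑ᶠ x : G.V, fv K G x) 1

/-- The Leavitt path algebra `L_K(G)` of a finite graph `G` with coefficients in `K`. -/
def LeavittPathAlgebra : Type (max u v w) := RingQuot (LeavittRel K G)

noncomputable instance : Ring (LeavittPathAlgebra K G) :=
  inferInstanceAs (Ring (RingQuot (LeavittRel K G)))

noncomputable instance : Algebra K (LeavittPathAlgebra K G) :=
  inferInstanceAs (Algebra K (RingQuot (LeavittRel K G)))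

end Leavitt

end FinGraph

section Corner

variable {K : Type*} {R : Type*} [CommRing K] [Ring R] [Algebra K R]

/-- The corner `pRp` of a `K`-algebra is a `K`-algebra, with `c • (p a p) = p (c • a) p`. -/
noncomputable instance cornerAlgebra {p : R} (hp : IsIdempotentElem p) : Algebra K hp.Corner where
  smul c a := ⟨c • a.1, by
    obtain ⟨b, hb⟩ := a.2
    exact ⟨c • b, by rw [← hb]; simp⟩⟩
  algebraMap :=
    { toFun := fun c => ⟨c • p, ⟨c • p, by simp [hp.eq]⟩⟩
      map_one' := Subtype.ext (one_smul K p)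
      map_zero' := Subtype.ext (zero_smul K p)
      map_add' := fun c d => Subtype.ext (add_smul c d p)
      map_mul' := fun c d => Subtype.ext (by
        change (c * d) • p = (c • p) * (d • p)
        rw [smul_mul_smul_comm, hp.eq]) }
  commutes' c a := Subtype.ext (by
    have h := (Subsemigroup.mem_corner_iff hp).mp a.2
    change (c • p) * a.1 = a.1 * (c • p)
    rw [smul_mul_assoc, mul_smul_comm, h.1, h.2])
  smul_def' c a := Subtype.ext (by
    have h := (Subsemigroup.mem_corner_iff hp).mp a.2
    change c • a.1 = (c • p) * a.1
    rw [smul_mul_assoc, h.1])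

/-- A full idempotent `p` of `R`: an idempotent with `RpR = R`. -/
def IsFullIdempotent (p : R) : Prop := IsIdempotentElem p ∧ TwoSidedIdeal.span {p} = ⊤

end Corner

/-!
Write `B = L_K(E)` and `C = K ^ k × L_K(F)`. Both assertions follow from the fact that `C` is
isomorphic to a corner `e B e` at a full idempotent `e` of `B`. The isomorphism is encoded as a
homomorphism `C → B` that does not preserve `1` (`IsFullCorner`). Such homomorphisms can be
composed, and `id × f` is one if `f` is, so it suffices to treat a single step of the passage from
`E` to `F`.

* Collapse at a regular vertex `x` without a loop (`isFullCorner_collapseHom`): the homomorphism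
  `[ef] ↦ e f` identifies the Leavitt path algebra of the collapse with the corner at `1 - x`. The
  idempotent `1 - x` is full because `x = ∑ f f*`, summed over the edges that `x` emits, none of
  which ends at `x`. Write `1 = ∑ a i * b i`, where the `a i` are `1 - x` and the edges `f`, and the
  `b i` are `1 - x` and the ghosts `f*`. The image is the whole corner because all entries
  `b i * z * a j` lie in it. The homomorphism is injective because `z ↦ (b i * z * a j)`, computed
  on generators, defines a homomorphism back to matrices over the Leavitt path algebra of the
  collapse (`LeavittFamily.expand`), whose existence follows from the universal property.
* Elimination of a source that is not a sink: this is the collapse at that source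
  (`Subgraph.sourceElimIso`).
* Elimination of an isolated vertex (`isFullCorner_isolatedHom`): this splits off a factor `K`. As
  eliminations do not touch the edges emitted by the remaining vertices, the isolated vertices that
  are eliminated are precisely the sinks of `E` outside `E_sf`; there are `k` of them.

Given the full corner `C = e B e`, the functor `M ↦ e M` is an equivalence from `B`-modules to
`C`-modules (`IsFullCorner.isMoritaEquivalent`). Moreover, if `1 = ∑ a i e b i`, then
`z ↦ (e b i z a j e)` identifies `B` with a full corner of a matrix algebra over `C`
(`IsFullCorner.isFullCorner_toMatrix`). This corner is a product of `k` corners of `M_n(K)`, each of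
them the endomorphism algebra of the range of a nonzero idempotent matrix, and a full corner of
`M_n(L_K(F))` (`IsFullCorner.exists_algEquiv`).
-/

/-! ### Full corners -/

/-- A homomorphism of `K`-algebras, not required to preserve `1`, that identifies `A` with the
corner `e B e` of `B` at the idempotent `e = f 1`, where `e` is full: `B e B = B`. Fullness is
encoded by an equation `∑ i, a i * e * b i = 1`, from which matrices over `A` are built. -/
structure IsFullCorner {K A B : Type*} [CommRing K] [Ring A] [Ring B] [Algebra K A] [Algebra K B]
    (f : A →ₙₐ[K] B) : Prop where
  injective : Function.Injective f
  exists_eq : ∀ x, f 1 * x * f 1 = x → ∃ a, f a = x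
  exists_sum : ∃ (n : ℕ) (a b : Fin n → B), ∑ i, a i * f 1 * b i = 1

namespace IsFullCorner

section Basic

variable {K A B C : Type*} [CommRing K] [Ring A] [Ring B] [Ring C] [Algebra K A] [Algebra K B]
  [Algebra K C] {f : A →ₙₐ[K] B} {g : B →ₙₐ[K] C}

lemma map_one_mul (f : A →ₙₐ[K] B) (a : A) : f 1 * f a = f a := by rw [← map_mul, one_mul]

lemma map_mul_one (f : A →ₙₐ[K] B) (a : A) : f a * f 1 = f a := by rw [← map_mul, mul_one]

lemma isIdempotentElem (f : A →ₙₐ[K] B) : IsIdempotentElem (f 1) := map_one_mul f 1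

lemma map_one_mul_cancel (f : A →ₙₐ[K] B) (x : B) : f 1 * (f 1 * x) = f 1 * x := by
  rw [← mul_assoc, (isIdempotentElem f).eq]

/-- In `IsFullCorner.exists_sum`, any finite index type may be used in place of `Fin n`. -/
lemma exists_sum_of_fintype {ι : Type*} [Fintype ι] {e : B} (a b : ι → B)
    (h : ∑ i, a i * e * b i = 1) : ∃ (n : ℕ) (a b : Fin n → B), ∑ i, a i * e * b i = 1 := by
  refine ⟨Fintype.card ι, a ∘ (Fintype.equivFin ι).symm, b ∘ (Fintype.equivFin ι).symm, ?_⟩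
  rw [← h]
  exact (Fintype.equivFin ι).symm.sum_comp fun i => a i * e * b i

lemma of_bijective (hf : Function.Bijective f) : IsFullCorner f := by
  have h1 : f 1 = 1 := by
    obtain ⟨a, ha⟩ := hf.2 1
    rw [← mul_one (f 1), ← ha, map_one_mul]
  refine ⟨hf.1, fun x _ => hf.2 x, 1, 1, 1, by simp [h1]⟩

lemma comp (hg : IsFullCorner g) (hf : IsFullCorner f) : IsFullCorner (g.comp f) := by
  refine ⟨hg.injective.comp hf.injective, fun x hx => ?_, ?_⟩
  · simp only [NonUnitalAlgHom.coe_comp, Function.comp_apply] at hx ⊢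
    obtain ⟨y, rfl⟩ := hg.exists_eq x (by
      rw [← hx]
      simp only [mul_assoc, map_mul_one]
      simp only [← mul_assoc, map_one_mul])
    obtain ⟨z, rfl⟩ := hf.exists_eq y (hg.injective (by simpa using hx))
    exact ⟨z, rfl⟩
  · obtain ⟨n, a, b, h⟩ := hf.exists_sum
    obtain ⟨m, c, d, h'⟩ := hg.exists_sum
    refine exists_sum_of_fintype (ι := Fin m × Fin n) (fun i => c i.1 * g (a i.2))
      (fun i => g (b i.2) * d i.1) ?_
    rw [← h', Fintype.sum_prod_type]
    refine Finset.sum_congr rfl fun i _ => ?_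
    rw [← h, map_sum, Finset.mul_sum, Finset.sum_mul]
    simp [mul_assoc]

/-- The homomorphism `(c, a) ↦ (c, f a)`. -/
def idProd (C : Type*) [Ring C] [Algebra K C] (f : A →ₙₐ[K] B) : C × A →ₙₐ[K] C × B :=
  NonUnitalAlgHom.prod (NonUnitalAlgHom.fst K C A) (f.comp (NonUnitalAlgHom.snd K C A))

@[simp] lemma idProd_apply (x : C × A) : idProd C f x = (x.1, f x.2) := rfl

lemma isFullCorner_idProd (hf : IsFullCorner f) : IsFullCorner (idProd C f) := by
  refine ⟨fun x y h => ?_, fun x hx => ?_, ?_⟩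
  · simp only [idProd_apply, Prod.mk.injEq] at h
    exact Prod.ext h.1 (hf.injective h.2)
  · obtain ⟨a, ha⟩ := hf.exists_eq x.2 (by simpa using congrArg Prod.snd hx)
    exact ⟨(x.1, a), by simp [ha]⟩
  · obtain ⟨n, a, b, h⟩ := hf.exists_sum
    refine ⟨n + 1, Fin.cons (1, 0) fun i => (0, a i), Fin.cons (1, 0) fun i => (0, b i), ?_⟩
    rw [Fin.sum_univ_succ]
    ext <;> simp [Prod.fst_sum, Prod.snd_sum, h]

/-- The compression `x ↦ e x e`, where `e = f 1`, as a map from `B` to `A`. -/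
noncomputable def compress (hf : IsFullCorner f) (x : B) : A :=
  (hf.exists_eq (f 1 * x * f 1) (by
    simp only [mul_assoc, map_mul_one]
    simp only [← mul_assoc, map_one_mul])).choose

@[simp] lemma map_compress (hf : IsFullCorner f) (x : B) : f (hf.compress x) = f 1 * x * f 1 :=
  Exists.choose_spec (p := fun a => f a = f 1 * x * f 1) _

lemma compress_add (hf : IsFullCorner f) (x y : B) :
    hf.compress (x + y) = hf.compress x + hf.compress y :=
  hf.injective (by simp [mul_add, add_mul])

lemma compress_smul (hf : IsFullCorner f) (c : K) (x : B) :
    hf.compress (c • x) = c • hf.compress x :=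
  hf.injective (by simp)

lemma compress_map (hf : IsFullCorner f) (a : A) : hf.compress (f a) = a :=
  hf.injective (by simp [map_one_mul, map_mul_one])

end Basic

section Matrix

variable {K A B : Type*} [CommRing K] [Ring A] [Ring B] [Algebra K A] [Algebra K B]
  {f : A →ₙₐ[K] B}

/-- If `1 = ∑ i, a i * e * b i`, where `e = f 1`, then every `z : B` is `∑ i j, a i z' b j`, where
`z' = e (b i) z (a j) e` belongs to the corner `A`. This is the homomorphism from `B` to the
matrices over `A` that sends `z` to these coefficients. -/
noncomputable def toMatrix (hf : IsFullCorner f) {n : ℕ} (a b : Fin n → B)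
    (h : ∑ i, a i * f 1 * b i = 1) : B →ₙₐ[K] Matrix (Fin n) (Fin n) A where
  toFun z := .of fun i j => hf.compress (b i * z * a j)
  map_smul' c z := by ext i j; simp [compress_smul]
  map_zero' := by ext i j; exact hf.injective (by simp)
  map_add' x y := by ext i j; simp [mul_add, add_mul, compress_add]
  map_mul' x y := by
    ext i j
    apply hf.injective
    simp only [Matrix.of_apply, map_compress, Matrix.mul_apply, map_sum, map_mul]
    calc f 1 * (b i * (x * y) * a j) * f 1
        = f 1 * (b i * (x * (∑ k, a k * f 1 * b k) * y) * a j) * f 1 := by rw [h, mul_one]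
      _ = _ := by
        simp only [Finset.mul_sum, Finset.sum_mul]
        refine Finset.sum_congr rfl fun k _ => ?_
        simp only [mul_assoc, map_one_mul_cancel]

lemma toMatrix_apply (hf : IsFullCorner f) {n : ℕ} (a b : Fin n → B)
    (h : ∑ i, a i * f 1 * b i = 1) (z : B) (i j : Fin n) :
    hf.toMatrix a b h z i j = hf.compress (b i * z * a j) := rfl

/-- The relation of being a full corner can be reversed, at the cost of passing to matrices. -/
lemma isFullCorner_toMatrix (hf : IsFullCorner f) {n : ℕ} (a b : Fin n → B)
    (h : ∑ i, a i * f 1 * b i = 1) : IsFullCorner (hf.toMatrix a b h) := by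
  refine ⟨fun x y hxy => ?_, fun X hX => ?_, ?_⟩
  · have key : ∀ z : B, z = ∑ i, ∑ j, a i * f (hf.toMatrix a b h z i j) * b j := fun z => by
      conv_lhs => rw [← one_mul z, ← mul_one (1 * z), ← h]
      simp only [Finset.mul_sum, Finset.sum_mul, toMatrix_apply, map_compress]
      rw [Finset.sum_comm]
      simp only [mul_assoc]
    rw [key x, key y, hxy]
  -- The preimage of a matrix `X` of the corner is the element with coefficients `X i j`.
  · refine ⟨∑ i, ∑ j, a i * f (X i j) * b j, ?_⟩
    ext k l
    apply hf.injective
    conv_rhs => rw [← hX]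
    simp only [Matrix.mul_apply, Finset.sum_mul, map_sum, map_mul, toMatrix_apply, map_compress,
      mul_one, Finset.mul_sum]
    rw [Finset.sum_comm]
    refine Finset.sum_congr rfl fun j _ => Finset.sum_congr rfl fun i _ => ?_
    rw [← map_mul_one f (X i j), ← map_one_mul f (X i j)]
    simp only [mul_assoc, map_one_mul_cancel]
  -- If `P` is the image of `1`, then `∑ i j, (e a i e) * P i j * (e b j e) = e`; every diagonal
  -- matrix unit is thus a two-sided multiple of `P`.
  · refine ⟨n, fun k => ∑ i, Matrix.single k i (hf.compress (a i)),
      fun k => ∑ j, Matrix.single j k (hf.compress (b j)), ?_⟩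
    obtain ⟨P, hP⟩ : ∃ P : Matrix (Fin n) (Fin n) A, P = hf.toMatrix a b h 1 := ⟨_, rfl⟩
    have h1 : ∑ i, ∑ j, hf.compress (a i) * P i j * hf.compress (b j) = 1 := by
      apply hf.injective
      simp only [map_sum, map_mul, hP, toMatrix_apply, map_compress, mul_one]
      calc _ = f 1 * (∑ i, a i * f 1 * b i) * (∑ j, a j * f 1 * b j) * f 1 := by
            simp only [Finset.mul_sum, Finset.sum_mul]
            rw [Finset.sum_comm]
            simp only [mul_assoc, map_one_mul_cancel]
        _ = f 1 := by rw [h, mul_one, mul_one, (isIdempotentElem f).eq]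
    rw [← hP, ← Matrix.sum_single_one]
    refine Finset.sum_congr rfl fun k _ => ?_
    rw [← Matrix.singleAddMonoidHom_apply k k, ← h1]
    simp only [map_sum, Matrix.singleAddMonoidHom_apply, Finset.sum_mul, Finset.mul_sum,
      Matrix.single_mul_mul_single]
    rw [Finset.sum_comm]

end Matrix

end IsFullCorner

/-! ### Corners of matrix algebras -/

section Corner

variable {K A B C : Type*} [CommRing K] [Ring A] [Ring B] [Ring C] [Algebra K A] [Algebra K B]
  [Algebra K C]

open IsFullCorner

/-- A homomorphism that need not preserve `1`, as a unital homomorphism to the corner at the image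
of `1`. -/
def NonUnitalAlgHom.toCorner (f : A →ₙₐ[K] B) {p : B} (hp : IsIdempotentElem p) (h : f 1 = p) :
    A →ₐ[K] hp.Corner where
  toFun a := ⟨f a, f a, by simp only [← h]; rw [map_one_mul, map_mul_one]⟩
  map_one' := Subtype.ext h
  map_mul' _ _ := Subtype.ext (map_mul f _ _)
  map_zero' := Subtype.ext (map_zero f)
  map_add' _ _ := Subtype.ext (map_add f _ _)
  commutes' c := Subtype.ext (by
    change f (algebraMap K A c) = c • p
    rw [Algebra.algebraMap_eq_smul_one, map_smul, h])

lemma isFullIdempotent_of_sum {p : B} (hp : IsIdempotentElem p) {n : ℕ} {a b : Fin n → B}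
    (h : ∑ i, a i * p * b i = 1) : IsFullIdempotent p := by
  refine ⟨hp, ?_⟩
  rw [← TwoSidedIdeal.one_mem_iff, ← h]
  refine sum_mem fun i _ => TwoSidedIdeal.mul_mem_right _ _ _ (TwoSidedIdeal.mul_mem_left _ _ _ ?_)
  exact TwoSidedIdeal.subset_span rfl

lemma IsFullCorner.isFullIdempotent {f : A →ₙₐ[K] B} (hf : IsFullCorner f) :
    IsFullIdempotent (f 1) :=
  let ⟨_, _, _, h⟩ := hf.exists_sum
  isFullIdempotent_of_sum (IsFullCorner.isIdempotentElem f) h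

lemma IsFullIdempotent.map {p : B} (hp : IsFullIdempotent p) (g : B →ₐ[K] C) :
    IsFullIdempotent (g p) := by
  refine ⟨hp.1.map g, ?_⟩
  have h : TwoSidedIdeal.span {p} ≤ (TwoSidedIdeal.span {g p}).comap g :=
    TwoSidedIdeal.span_le.2 (Set.singleton_subset_iff.2
      ((TwoSidedIdeal.mem_comap g).2 (TwoSidedIdeal.subset_span rfl)))
  rw [hp.2] at h
  have := (TwoSidedIdeal.mem_comap g).1 (h (x := 1) (by trivial))
  rwa [map_one, TwoSidedIdeal.one_mem_iff] at this

lemma IsFullIdempotent.ne_zero [Nontrivial B] {p : B} (hp : IsFullIdempotent p) : p ≠ 0 := by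
  rintro rfl
  have h : TwoSidedIdeal.span {(0 : B)} ≤ ⊥ :=
    TwoSidedIdeal.span_le.2 (Set.singleton_subset_iff.2 (zero_mem _))
  rw [hp.2] at h
  exact bot_ne_top (α := TwoSidedIdeal B) (le_antisymm bot_le h)

end Corner

section MatrixCorner

variable {K : Type*} [Field K]

/-- The corner of `Mₙ(K)` at a nonzero idempotent `p` is the endomorphism algebra of the range of
`p`, hence a full matrix algebra. -/
lemma exists_corner_algEquiv_matrix {n : ℕ} {p : Matrix (Fin n) (Fin n) K}
    (hp : IsIdempotentElem p) (h0 : p ≠ 0) :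
    ∃ m : ℕ, 0 < m ∧ Nonempty (hp.Corner ≃ₐ[K] Matrix (Fin m) (Fin m) K) := by
  classical
  set π := Matrix.toLin' p with hπ
  have hππ : ∀ x, π (π x) = π x := fun x => by
    rw [← LinearMap.comp_apply, ← Matrix.toLin'_mul, hp.eq]
  let W := LinearMap.range π
  have hW : ∀ w : W, π w = w := by
    rintro ⟨_, x, rfl⟩
    exact hππ x
  have hr : ∀ w : W, π.rangeRestrict w = w := fun w => Subtype.ext (hW w)
  let f : Module.End K W →ₙₐ[K] Matrix (Fin n) (Fin n) K :=
    { toFun := fun T => LinearMap.toMatrix' (W.subtype ∘ₗ T ∘ₗ π.rangeRestrict)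
      map_smul' := fun c T => by
        rw [LinearMap.smul_comp, LinearMap.comp_smul, map_smul]; rfl
      map_zero' := by simp
      map_add' := fun S T => by rw [LinearMap.add_comp, LinearMap.comp_add, map_add]
      map_mul' := fun S T => by
        rw [← LinearMap.toMatrix'_comp]
        congr 1
        refine LinearMap.ext fun x => ?_
        simp only [LinearMap.comp_apply, Submodule.subtype_apply, hr, Module.End.mul_apply] }
  have hf : ∀ T, f T = LinearMap.toMatrix' (W.subtype ∘ₗ T ∘ₗ π.rangeRestrict) := fun _ => rfl
  have h1 : f 1 = p := by
    rw [hf, ← LinearMap.toMatrix'_toLin' p]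
    rfl
  let e : Module.End K W ≃ₐ[K] hp.Corner := AlgEquiv.ofBijective (f.toCorner hp h1) <| by
    refine ⟨fun S T h => ?_, fun x => ?_⟩
    · have h' : f S = f T := congrArg Subtype.val h
      rw [hf, hf] at h'
      have h'' := LinearMap.toMatrix'.injective h'
      refine LinearMap.ext fun w => Subtype.ext ?_
      have := LinearMap.congr_fun h'' w
      simpa only [LinearMap.comp_apply, Submodule.subtype_apply, hr] using this
    · obtain ⟨hx1, hx2⟩ := (Subsemigroup.mem_corner_iff hp).mp x.2
      refine ⟨π.rangeRestrict ∘ₗ Matrix.toLin' x.1 ∘ₗ W.subtype, Subtype.ext ?_⟩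
      change f _ = x.1
      rw [hf]
      conv_rhs =>
        rw [← hx1, ← hx2, ← LinearMap.toMatrix'_toLin' (p * (x.1 * p)), Matrix.toLin'_mul,
          Matrix.toLin'_mul]
      rfl
  refine ⟨Module.finrank K W, ?_, ⟨e.symm.trans (algEquivMatrix (Module.finBasis K W))⟩⟩
  rw [Module.finrank_pos_iff, Submodule.nontrivial_iff_ne_bot]
  intro h
  apply h0
  rw [LinearMap.range_eq_bot] at h
  exact Matrix.toLin'.injective (by rw [← hπ, h, map_zero])

/-- If `K ^ k × L` is a full corner of `B`, then `B` is the product of `k` matrix algebras over `K`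
and a full corner of a matrix algebra over `L`: the factors are the components of the corner of
`Mₙ(K ^ k × L)` given by `IsFullCorner.toMatrix`. -/
lemma IsFullCorner.exists_algEquiv {L B : Type*} [Ring L] [Ring B] [Algebra K L] [Algebra K B]
    {k : ℕ} {f : ((Fin k → K) × L) →ₙₐ[K] B} (hf : IsFullCorner f) :
    ∃ (m : Fin k → ℕ) (n : ℕ) (p : Matrix (Fin n) (Fin n) L) (hp : IsFullIdempotent p),
      (∀ i, 0 < m i) ∧ 0 < n ∧
      Nonempty (B ≃ₐ[K] ((i : Fin k) → Matrix (Fin (m i)) (Fin (m i)) K) × hp.1.Corner) := by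
  obtain ⟨n, a, b, h, hn⟩ : ∃ (n : ℕ) (a b : Fin n → B), ∑ i, a i * f 1 * b i = 1 ∧ 0 < n := by
    obtain ⟨n, a, b, h⟩ := hf.exists_sum
    -- A zero summand is added, as the size of the matrices is to be positive.
    exact ⟨n + 1, Fin.cons 0 a, Fin.cons 0 b, by simpa [Fin.sum_univ_succ] using h, by simp⟩
  have hθ := hf.isFullCorner_toMatrix a b h
  set θ := hf.toMatrix a b h
  have := Fin.pos_iff_nonempty.1 hn
  let π (i : Fin k) : ((Fin k → K) × L) →ₐ[K] K := (Pi.evalAlgHom K _ i).comp (AlgHom.fst K _ L)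
  let σ : ((Fin k → K) × L) →ₐ[K] L := AlgHom.snd K _ L
  let θ₁ (i : Fin k) : B →ₙₐ[K] Matrix (Fin n) (Fin n) K :=
    ((π i).mapMatrix (m := Fin n) : _ →ₙₐ[K] _).comp θ
  let θ₂ : B →ₙₐ[K] Matrix (Fin n) (Fin n) L := (σ.mapMatrix (m := Fin n) : _ →ₙₐ[K] _).comp θ
  have hp (i : Fin k) : IsFullIdempotent (θ₁ i 1) :=
    hθ.isFullIdempotent.map (π i).mapMatrix
  have hq : IsFullIdempotent (θ₂ 1) :=
    hθ.isFullIdempotent.map σ.mapMatrix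
  choose m hm e using fun i => exists_corner_algEquiv_matrix (hp i).1 (hp i).ne_zero
  refine ⟨m, n, θ₂ 1, hq, hm, hn, ⟨?_⟩⟩
  let Θ : B →ₐ[K] ((i : Fin k) → (hp i).1.Corner) × hq.1.Corner :=
    (AlgHom.pi fun i => (θ₁ i).toCorner (hp i).1 rfl).prod (θ₂.toCorner hq.1 rfl)
  have hΘ : Function.Bijective Θ := by
    refine ⟨fun x y hxy => ?_, fun ⟨x, y⟩ => ?_⟩
    · have h1 := fun i => congrArg Subtype.val (congrFun (congrArg Prod.fst hxy) i)
      have h2 := congrArg Subtype.val (congrArg Prod.snd hxy)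
      apply hθ.injective
      ext i j l
      · exact congrFun (congrFun (h1 l) i) j
      · exact congrFun (congrFun h2 i) j
    · let X : Matrix (Fin n) (Fin n) ((Fin k → K) × L) :=
        .of fun i j => (fun l => (x l).1 i j, y.1 i j)
      have hX1 (l : Fin k) : (π l).mapMatrix X = (x l).1 := rfl
      have hX2 : σ.mapMatrix X = y.1 := rfl
      have hx (l : Fin k) := (Subsemigroup.mem_corner_iff (hp l).1).mp (x l).2
      have hy := (Subsemigroup.mem_corner_iff hq.1).mp y.2
      have hext {X Y : Matrix (Fin n) (Fin n) ((Fin k → K) × L)}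
          (h1 : ∀ l, (π l).mapMatrix X = (π l).mapMatrix Y)
          (h2 : σ.mapMatrix X = σ.mapMatrix Y) : X = Y := by
        ext i j l
        · exact congrFun (congrFun (h1 l) i) j
        · exact congrFun (congrFun h2 i) j
      obtain ⟨z, hz⟩ := hθ.exists_eq X <| hext (fun l => by
          rw [map_mul, map_mul, hX1]
          exact (congrArg (· * _) (hx l).1).trans (hx l).2) (by
          rw [map_mul, map_mul, hX2]
          exact (congrArg (· * _) hy.1).trans hy.2)
      refine ⟨z, Prod.ext (funext fun l => Subtype.ext ?_) (Subtype.ext ?_)⟩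
      · exact congrArg (π l).mapMatrix hz
      · exact congrArg σ.mapMatrix hz
  exact (AlgEquiv.ofBijective Θ hΘ).trans
    (AlgEquiv.prodCongr (AlgEquiv.piCongrRight fun i => (e i).some) AlgEquiv.refl)

end MatrixCorner

/-! ### Full corners and Morita equivalence -/

section Morita

open CategoryTheory

universe u₁ u₂ u₃ u₄

variable {K : Type u₃} {A : Type u₁} {B : Type u₂} [CommRing K] [Ring A] [Ring B] [Algebra K A]
  [Algebra K B]

open IsFullCorner

/-- The subgroup `e M` of a `B`-module `M`, where `e = f 1`. -/
def cornerModule (f : A →ₙₐ[K] B) (M : Type*) [AddCommGroup M] [Module B M] : AddSubgroup M where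
  carrier := {m | f 1 • m = m}
  zero_mem' := smul_zero _
  add_mem' {x y} hx hy := by
    change _ • _ = _
    rw [smul_add, hx, hy]
  neg_mem' {x} hx := by
    change _ • _ = _
    rw [smul_neg, hx]

namespace cornerModule

variable (f : A →ₙₐ[K] B) (M : Type*) [AddCommGroup M] [Module B M]

variable {M} in
lemma smul_mem (b : B) (m : M) : (f 1 * b) • m ∈ cornerModule f M := by
  change _ • _ = _
  rw [smul_smul, map_one_mul_cancel]

/-- `A` acts on `e M` through `f`. -/
instance : Module A (cornerModule f M) where
  smul a m := ⟨f a • m.1, by rw [← map_one_mul]; exact smul_mem f _ _⟩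
  one_smul m := Subtype.ext m.2
  mul_smul a b m := Subtype.ext (by
    change f (a * b) • m.1 = f a • f b • m.1
    rw [map_mul, mul_smul])
  smul_zero a := Subtype.ext (smul_zero (f a))
  smul_add a m n := Subtype.ext (smul_add (f a) m.1 n.1)
  add_smul a b m := Subtype.ext (by
    change f (a + b) • m.1 = f a • m.1 + f b • m.1
    rw [map_add, add_smul])
  zero_smul m := Subtype.ext (by
    change f 0 • m.1 = 0
    rw [map_zero, zero_smul])

variable {M}

lemma coe_smul (a : A) (m : cornerModule f M) : ((a • m : cornerModule f M) : M) = f a • m.1 := rfl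

lemma one_smul_coe (m : cornerModule f M) : f 1 • (m : M) = m := m.2

variable {N : Type*} [AddCommGroup N] [Module B N]

/-- The restriction of a linear map to a map from `e M` to `e N`. -/
def map (g : M →ₗ[B] N) : cornerModule f M →ₗ[A] cornerModule f N where
  toFun m := ⟨g m.1, by
    change _ • _ = _
    rw [← map_smul, one_smul_coe]⟩
  map_add' x y := Subtype.ext (map_add g x.1 y.1)
  map_smul' a x := Subtype.ext (map_smul g (f a) x.1)

end cornerModule

open cornerModule

/-- The functor `M ↦ e M` from `B`-modules to `A`-modules. -/
def cornerFunctor (f : A →ₙₐ[K] B) : ModuleCat.{u₄} B ⥤ ModuleCat.{u₄} A where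
  obj M := ModuleCat.of A (cornerModule f M)
  map g := ModuleCat.ofHom (cornerModule.map f g.hom)

/-- The group `Hom_A(e B, N)`, where `A` acts on `e B` through `f`. Its elements are encoded as
additive maps `g` on all of `B` with `g (f a * b) = a • g b`; the case `a = 1` shows that `g` is
determined by its values on `e B`. -/
def CornerHom (f : A →ₙₐ[K] B) (N : Type*) [AddCommGroup N] [Module A N] :
    AddSubgroup (B →+ N) where
  carrier := {g | ∀ a b, g (f a * b) = a • g b}
  zero_mem' _ _ := (smul_zero _).symm
  add_mem' hg hh a b := by
    simp [hg a b, hh a b]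
  neg_mem' hg a b := by
    simp [hg a b]

/-- `B` acts on `Hom_A(e B, N)` by right multiplication on `e B`. -/
instance (f : A →ₙₐ[K] B) (N : Type*) [AddCommGroup N] [Module A N] :
    Module B (CornerHom f N) where
  smul b g := ⟨g.1.comp (AddMonoidHom.mulRight b), fun a x => by
    simpa [mul_assoc] using g.2 a (x * b)⟩
  one_smul g := Subtype.ext (AddMonoidHom.ext fun x => congrArg g.1 (mul_one x))
  mul_smul b c g := Subtype.ext (AddMonoidHom.ext fun x => congrArg g.1 (mul_assoc x b c).symm)
  smul_zero b := rfl
  smul_add b g h := rfl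
  add_smul b c g := Subtype.ext (AddMonoidHom.ext fun x =>
    (congrArg g.1 (mul_add x b c)).trans (map_add g.1 _ _))
  zero_smul g := Subtype.ext (AddMonoidHom.ext fun x =>
    (congrArg g.1 (mul_zero x)).trans (map_zero g.1))

lemma CornerHom.smul_apply (f : A →ₙₐ[K] B) {N : Type*} [AddCommGroup N] [Module A N] (b x : B)
    (g : CornerHom f N) : (b • g).1 x = g.1 (x * b) := rfl

namespace IsFullCorner

variable {f : A →ₙₐ[K] B}

lemma cornerFunctor_faithful (hf : IsFullCorner f) :
    (cornerFunctor.{u₁, u₂, u₃, u₄} f).Faithful where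
  map_injective {M N} g h hgh := by
    obtain ⟨n, a, b, hab⟩ := hf.exists_sum
    ext m
    have key (x : M) : g.hom (f 1 • x) = h.hom (f 1 • x) :=
      congrArg Subtype.val (LinearMap.congr_fun (congrArg ModuleCat.Hom.hom hgh)
        (⟨f 1 • x, by simpa using smul_mem f 1 x⟩ : cornerModule f M))
    rw [← one_smul B m, ← hab, Finset.sum_smul, map_sum, map_sum]
    refine Finset.sum_congr rfl fun i _ => ?_
    rw [mul_smul, mul_smul, map_smul g.hom (a i), map_smul h.hom (a i), key]

/-- A map `γ : e M → e N` extends to `m ↦ ∑ i, a i • γ (e (b i) m)`, where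
`1 = ∑ i, a i * e * b i`. -/
lemma cornerFunctor_full (hf : IsFullCorner f) : (cornerFunctor.{u₁, u₂, u₃, u₄} f).Full where
  map_surjective {M N} g := by
    obtain ⟨n, a, b, hab⟩ := hf.exists_sum
    let γ : cornerModule f M →ₗ[A] cornerModule f N := g.hom
    let c (x : B) (m : M) : cornerModule f M := ⟨(f 1 * x) • m, smul_mem f x m⟩
    have hc (x : B) (m m' : M) : c x (m + m') = c x m + c x m' := Subtype.ext (smul_add _ _ _)
    have hsum (x : B) (m : M) : (∑ j, hf.compress (x * a j) • c (b j) m) = c x m :=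
      Subtype.ext <| by
        rw [AddSubgroup.val_finsetSum]
        simp only [coe_smul, map_compress, c, smul_smul, ← Finset.sum_smul]
        congr 1
        conv_rhs => rw [← mul_one (f 1 * x), ← hab, Finset.mul_sum]
        simp only [mul_assoc, map_one_mul_cancel]
    have hγ (x : B) (m : M) : (f 1 * x) • ∑ j, a j • (γ (c (b j) m) : N) = γ (c x m) := by
      rw [← hsum x m, map_sum, AddSubgroup.val_finsetSum, Finset.smul_sum]
      refine Finset.sum_congr rfl fun j _ => ?_
      rw [map_smul, coe_smul, map_compress, mul_smul _ (f 1), one_smul_coe, smul_smul, mul_assoc]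
    let h : M →ₗ[B] N :=
      { toFun := fun m => ∑ i, a i • (γ (c (b i) m) : N)
        map_add' := fun m m' => by
          simp only [hc, map_add, AddSubgroup.coe_add, smul_add, Finset.sum_add_distrib]
        map_smul' := fun r m => by
          have (i : Fin n) : c (b i) (r • m) = c (b i * r) m :=
            Subtype.ext (by simp only [c, smul_smul, mul_assoc])
          conv_rhs =>
            rw [RingHom.id_apply, ← one_smul B (r • ∑ i, a i • (γ (c (b i) m) : N)), ← hab,
              Finset.sum_smul]
          refine Finset.sum_congr rfl fun i _ => ?_
          rw [this, ← hγ, smul_smul, smul_smul]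
          simp only [mul_assoc] }
    refine ⟨ModuleCat.ofHom h, ?_⟩
    ext m
    apply Subtype.ext
    change ∑ i, a i • (γ (c (b i) m.1) : N) = γ m
    have h1 := hγ 1 m.1
    have h2 : c 1 m.1 = m := Subtype.ext (by simp only [c, mul_one]; exact one_smul_coe f m)
    rw [h2, mul_one] at h1
    rw [← h1]
    exact (congrArg h (one_smul_coe f m)).symm.trans (map_smul h (f 1) m.1)

/-- `N` is isomorphic to `e Hom_A(e B, N)`, by evaluation at `1`. -/
lemma cornerFunctor_essSurj (hf : IsFullCorner f) :
    (cornerFunctor.{u₁, u₂, u₃, max u₂ u₄} f).EssSurj where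
  mem_essImage N := by
    let e : cornerModule f (CornerHom f N) ≃ₗ[A] N :=
      { toFun := fun g => g.1.1 1
        map_add' := fun _ _ => rfl
        map_smul' := fun a g => by
          rw [coe_smul, CornerHom.smul_apply, one_mul, ← mul_one (f a), g.1.2, RingHom.id_apply]
        invFun := fun n => ⟨⟨
          { toFun := fun b => hf.compress b • n
            map_zero' := by
              rw [← map_zero f, compress_map, zero_smul]
            map_add' := fun x y => by rw [compress_add, add_smul] }, fun a b => by
            change hf.compress _ • n = a • hf.compress _ • n
            rw [smul_smul]
            congr 1
            apply hf.injective
            simp only [map_compress, map_mul, ← mul_assoc, map_one_mul, map_mul_one]⟩, by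
          refine Subtype.ext (AddMonoidHom.ext fun x => ?_)
          change hf.compress (x * f 1) • n = hf.compress x • n
          congr 1
          apply hf.injective
          simp only [map_compress, mul_assoc, (IsFullCorner.isIdempotentElem f).eq]⟩
        left_inv := fun g => by
          refine Subtype.ext (Subtype.ext (AddMonoidHom.ext fun x => ?_))
          change hf.compress x • g.1.1 1 = g.1.1 x
          have hg : g.1.1 x = g.1.1 (x * f 1) := by
            conv_lhs => rw [← one_smul_coe f g, CornerHom.smul_apply]
          rw [← g.1.2, mul_one, map_compress, hg, mul_assoc, g.1.2, one_smul]
        right_inv := fun n => by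
          change hf.compress 1 • n = n
          have : hf.compress 1 = 1 := hf.injective (by
            rw [map_compress, mul_one, (IsFullCorner.isIdempotentElem f).eq])
          rw [this, one_smul] }
    exact ⟨ModuleCat.of B (CornerHom f N), ⟨e.toModuleIso⟩⟩

open scoped ModuleCat.Algebra in
/-- An algebra is Morita equivalent to each of its full corners. -/
theorem isMoritaEquivalent (hf : IsFullCorner f) : IsMoritaEquivalent K B A := by
  have := hf.cornerFunctor_faithful
  have := hf.cornerFunctor_full
  have := hf.cornerFunctor_essSurj
  have : (cornerFunctor.{u₁, u₂, u₃, max u₂ u₁} f).IsEquivalence := {}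
  refine ⟨⟨⟨(cornerFunctor f).asEquivalence, ⟨?_⟩⟩⟩⟩
  intro M N g r
  ext m
  refine Subtype.ext ?_
  change algebraMap K B r • g.hom m.1 = f (algebraMap K A r) • g.hom m.1
  rw [Algebra.algebraMap_eq_smul_one, Algebra.algebraMap_eq_smul_one r, map_smul, smul_assoc,
    smul_assoc, one_smul, ← map_smul g.hom]
  exact congrArg (fun x => r • g.hom x) (one_smul_coe f (M := M) m).symm

end IsFullCorner

end Morita

/-! ### The universal property of Leavitt path algebras -/

namespace FinGraph

/-- Elements of a ring `R` that satisfy the defining relations of the Leavitt path algebra of `G`,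
except that the sum of the vertices, an idempotent of `R`, need not be `1`. -/
structure LeavittFamily (G : FinGraph.{u, v}) (R : Type*) [Ring R] where
  vert : G.V → R
  edge : G.E → R
  ghost : G.E → R
  vert_mul_self : ∀ x, vert x * vert x = vert x
  vert_mul_ne : ∀ x y, x ≠ y → vert x * vert y = 0
  source_mul_edge : ∀ e, vert (G.s e) * edge e = edge e
  edge_mul_range : ∀ e, edge e * vert (G.r e) = edge e
  range_mul_ghost : ∀ e, vert (G.r e) * ghost e = ghost e
  ghost_mul_source : ∀ e, ghost e * vert (G.s e) = ghost e
  ghost_mul_self : ∀ e, ghost e * edge e = vert (G.r e)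
  ghost_mul_ne : ∀ e f, e ≠ f → ghost e * edge f = 0
  vert_eq_sum : ∀ x, G.IsRegular x →
    vert x = ∑ᶠ e : {e : G.E // G.s e = x}, edge e.1 * ghost e.1

namespace LeavittPathAlgebra

variable (K : Type w) [Field K] (G : FinGraph.{u, v})

/-- The quotient map from the free algebra. -/
noncomputable def mkHom : FreeAlgebra K G.LeavittGen →ₐ[K] G.LeavittPathAlgebra K :=
  RingQuot.mkAlgHom K (LeavittRel K G)

lemma mkHom_surjective : Function.Surjective (mkHom K G) := RingQuot.mkAlgHom_surjective K _

variable {K G} in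
lemma mkHom_rel {x y : FreeAlgebra K G.LeavittGen} (h : LeavittRel K G x y) :
    mkHom K G x = mkHom K G y :=
  RingQuot.mkAlgHom_rel K h

lemma map_finsum_of_finite {ι M N : Type*} [Finite ι] [AddCommMonoid M] [AddCommMonoid N]
    {F : Type*} [FunLike F M N] [AddMonoidHomClass F M N] (g : F) (f : ι → M) :
    g (∑ᶠ i, f i) = ∑ᶠ i, g (f i) :=
  map_finsum g (Set.toFinite _)

/-- The generators of the Leavitt path algebra. -/
noncomputable def gen : LeavittFamily G (G.LeavittPathAlgebra K) where
  vert x := mkHom K G (fv K G x)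
  edge e := mkHom K G (fe K G e)
  ghost e := mkHom K G (fg K G e)
  vert_mul_self x := by rw [← map_mul, mkHom_rel (.vert_mul_self x)]
  vert_mul_ne x y h := by rw [← map_mul, mkHom_rel (.vert_mul_ne x y h), map_zero]
  source_mul_edge e := by rw [← map_mul, mkHom_rel (.source_mul_edge e)]
  edge_mul_range e := by rw [← map_mul, mkHom_rel (.edge_mul_range e)]
  range_mul_ghost e := by rw [← map_mul, mkHom_rel (.range_mul_ghost e)]
  ghost_mul_source e := by rw [← map_mul, mkHom_rel (.ghost_mul_source e)]
  ghost_mul_self e := by rw [← map_mul, mkHom_rel (.ghost_mul_self e)]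
  ghost_mul_ne e f h := by rw [← map_mul, mkHom_rel (.ghost_mul_ne e f h), map_zero]
  vert_eq_sum x h := by
    rw [mkHom_rel (.vert_eq_sum x h), map_finsum_of_finite]
    simp only [map_mul]

lemma sum_vert : ∑ᶠ x, (gen K G).vert x = 1 := by
  rw [← map_one (mkHom K G), ← mkHom_rel .sum_vert, map_finsum_of_finite]
  rfl

variable {K G}

/-- The constants need no case of their own, as `1` is the sum of the vertices. -/
@[elab_as_elim]
lemma induction {motive : G.LeavittPathAlgebra K → Prop}
    (vert : ∀ x, motive ((gen K G).vert x)) (edge : ∀ e, motive ((gen K G).edge e))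
    (ghost : ∀ e, motive ((gen K G).ghost e))
    (zero : motive 0) (add : ∀ a b, motive a → motive b → motive (a + b))
    (mul : ∀ a b, motive a → motive b → motive (a * b))
    (smul : ∀ (c : K) a, motive a → motive (c • a)) (a : G.LeavittPathAlgebra K) : motive a := by
  obtain ⟨a, rfl⟩ := mkHom_surjective K G a
  induction a using FreeAlgebra.induction with
  | grade0 c =>
    rw [AlgHom.commutes, Algebra.algebraMap_eq_smul_one, ← sum_vert]
    exact smul c _ (finsum_induction motive zero add vert)
  | grade1 x =>
    cases x with
    | vert x => exact vert x
    | edge e => exact edge e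
    | ghost e => exact ghost e
  | mul a b ha hb => rw [map_mul]; exact mul _ _ ha hb
  | add a b ha hb => rw [map_add]; exact add _ _ ha hb

lemma hom_ext {R : Type*} [Ring R] [Algebra K R] {f g : G.LeavittPathAlgebra K →ₙₐ[K] R}
    (vert : ∀ x, f ((gen K G).vert x) = g ((gen K G).vert x))
    (edge : ∀ e, f ((gen K G).edge e) = g ((gen K G).edge e))
    (ghost : ∀ e, f ((gen K G).ghost e) = g ((gen K G).ghost e)) : f = g := by
  ext a
  induction a using induction with
  | vert x => exact vert x
  | edge e => exact edge e
  | ghost e => exact ghost e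
  | zero => simp
  | add a b ha hb => simp [ha, hb]
  | mul a b ha hb => simp [ha, hb]
  | smul c a ha => simp [ha]

end LeavittPathAlgebra

namespace LeavittFamily

open LeavittPathAlgebra

variable {K : Type w} [Field K] {G : FinGraph.{u, v}} {R : Type*} [Ring R] [Algebra K R]
  (F : LeavittFamily G R)

lemma isIdempotentElem_sum : IsIdempotentElem (∑ᶠ x, F.vert x) := by
  classical
  have := Fintype.ofFinite G.V
  rw [finsum_eq_sum_of_fintype, IsIdempotentElem, Finset.sum_mul_sum]
  refine Finset.sum_congr rfl fun x _ => ?_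
  rw [Finset.sum_eq_single x (fun y _ h => F.vert_mul_ne x y h.symm) (by simp), F.vert_mul_self]

lemma sum_mul_vert (x : G.V) : (∑ᶠ x, F.vert x) * F.vert x = F.vert x := by
  classical
  have := Fintype.ofFinite G.V
  rw [finsum_eq_sum_of_fintype, Finset.sum_mul,
    Finset.sum_eq_single x (fun y _ h => F.vert_mul_ne y x h) (by simp), F.vert_mul_self]

lemma vert_mul_sum (x : G.V) : F.vert x * (∑ᶠ x, F.vert x) = F.vert x := by
  classical
  have := Fintype.ofFinite G.V
  rw [finsum_eq_sum_of_fintype, Finset.mul_sum,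
    Finset.sum_eq_single x (fun y _ h => F.vert_mul_ne x y h.symm) (by simp), F.vert_mul_self]

lemma mem_corner_of_eq {x y : G.V} {a b c : R} (h1 : F.vert x * a = c) (h2 : b * F.vert y = c) :
    c ∈ Subsemigroup.corner (∑ᶠ x, F.vert x) := by
  rw [Subsemigroup.mem_corner_iff F.isIdempotentElem_sum]
  constructor
  · rw [← h1, ← mul_assoc, sum_mul_vert]
  · rw [← h2, mul_assoc, vert_mul_sum]

/-- The elements of a family, as elements of the corner at the sum of the vertices. -/
def cornerGen : G.LeavittGen → F.isIdempotentElem_sum.Corner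
  | .vert x => ⟨F.vert x, F.mem_corner_of_eq (F.vert_mul_self x) (F.vert_mul_self x)⟩
  | .edge e => ⟨F.edge e, F.mem_corner_of_eq (F.source_mul_edge e) (F.edge_mul_range e)⟩
  | .ghost e => ⟨F.ghost e, F.mem_corner_of_eq (F.range_mul_ghost e) (F.ghost_mul_source e)⟩

/-- The inclusion of a corner. -/
def cornerVal (K : Type*) {R : Type*} [Field K] [Ring R] [Algebra K R] {p : R}
    (hp : IsIdempotentElem p) : hp.Corner →ₙₐ[K] R where
  toFun := Subtype.val
  map_smul' _ _ := rfl
  map_zero' := rfl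
  map_add' _ _ := rfl
  map_mul' _ _ := rfl

lemma coe_finsum_corner (K : Type*) {R ι : Type*} [Field K] [Ring R] [Algebra K R] [Finite ι]
    {p : R} (hp : IsIdempotentElem p) (f : ι → hp.Corner) :
    (∑ᶠ i, f i).1 = ∑ᶠ i, (f i).1 :=
  map_finsum_of_finite (cornerVal K hp) f

variable (K) in
lemma lift_rel {x y : FreeAlgebra K G.LeavittGen} (h : LeavittRel K G x y) :
    FreeAlgebra.lift K F.cornerGen x = FreeAlgebra.lift K F.cornerGen y := by
  have hv x : FreeAlgebra.lift K F.cornerGen (fv K G x) = F.cornerGen (.vert x) :=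
    FreeAlgebra.lift_ι_apply _ _
  have he e : FreeAlgebra.lift K F.cornerGen (fe K G e) = F.cornerGen (.edge e) :=
    FreeAlgebra.lift_ι_apply _ _
  have hg e : FreeAlgebra.lift K F.cornerGen (fg K G e) = F.cornerGen (.ghost e) :=
    FreeAlgebra.lift_ι_apply _ _
  apply Subtype.ext
  cases h with
  | vert_mul_self x => rw [map_mul, hv]; exact F.vert_mul_self x
  | vert_mul_ne x y h => rw [map_mul, hv, hv, map_zero]; exact F.vert_mul_ne x y h
  | source_mul_edge e => rw [map_mul, hv, he]; exact F.source_mul_edge e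
  | edge_mul_range e => rw [map_mul, hv, he]; exact F.edge_mul_range e
  | range_mul_ghost e => rw [map_mul, hv, hg]; exact F.range_mul_ghost e
  | ghost_mul_source e => rw [map_mul, hv, hg]; exact F.ghost_mul_source e
  | ghost_mul_self e => rw [map_mul, hv, hg, he]; exact F.ghost_mul_self e
  | ghost_mul_ne e f h => rw [map_mul, hg, he, map_zero]; exact F.ghost_mul_ne e f h
  | vert_eq_sum x h =>
    rw [map_finsum_of_finite, coe_finsum_corner K, hv]
    simp only [map_mul, he, hg]
    exact F.vert_eq_sum x h
  | sum_vert =>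
    rw [map_finsum_of_finite, coe_finsum_corner K, map_one]
    simp only [hv]
    rfl

variable (K) in
/-- The universal property, for the corner at the sum of the vertices. -/
noncomputable def liftCorner : G.LeavittPathAlgebra K →ₐ[K] F.isIdempotentElem_sum.Corner :=
  RingQuot.liftAlgHom K (s := LeavittRel K G)
    ⟨FreeAlgebra.lift K F.cornerGen, fun _ _ h => F.lift_rel K h⟩

variable (K) in
/-- The universal property of the Leavitt path algebra for homomorphisms that need not preserve
`1`. -/
noncomputable def lift : G.LeavittPathAlgebra K →ₙₐ[K] R :=
  (cornerVal K F.isIdempotentElem_sum).comp (F.liftCorner K)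

lemma lift_mkHom (x : FreeAlgebra K G.LeavittGen) :
    F.lift K (mkHom K G x) =
      cornerVal K F.isIdempotentElem_sum (FreeAlgebra.lift K F.cornerGen x) :=
  congrArg (cornerVal K F.isIdempotentElem_sum)
    (RingQuot.liftAlgHom_mkAlgHom_apply (S := K) _ (fun _ _ h => F.lift_rel K h) x)

@[simp] lemma lift_vert (x : G.V) : F.lift K ((gen K G).vert x) = F.vert x :=
  (F.lift_mkHom _).trans (congrArg (cornerVal K F.isIdempotentElem_sum)
    (FreeAlgebra.lift_ι_apply F.cornerGen _))

@[simp] lemma lift_edge (e : G.E) : F.lift K ((gen K G).edge e) = F.edge e :=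
  (F.lift_mkHom _).trans (congrArg (cornerVal K F.isIdempotentElem_sum)
    (FreeAlgebra.lift_ι_apply F.cornerGen _))

@[simp] lemma lift_ghost (e : G.E) : F.lift K ((gen K G).ghost e) = F.ghost e :=
  (F.lift_mkHom _).trans (congrArg (cornerVal K F.isIdempotentElem_sum)
    (FreeAlgebra.lift_ι_apply F.cornerGen _))

lemma lift_one : F.lift K 1 = ∑ᶠ x, F.vert x := by
  rw [← sum_vert, map_finsum_of_finite]
  simp only [lift_vert]

end LeavittFamily

end FinGraph

/-! ### Isomorphic graphs and isolated vertices -/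

namespace FinGraph

open LeavittPathAlgebra

variable {K : Type w} [Field K]

/-- The family given by an injection on vertices and a bijection on edges that are compatible with
source and range. The vertices outside the image are isolated. -/
noncomputable def mapFamily {G H : FinGraph.{u, v}} (i : H.V → G.V) (hi : Function.Injective i)
    (τ : H.E ≃ G.E) (hs : ∀ e, G.s (τ e) = i (H.s e)) (hr : ∀ e, G.r (τ e) = i (H.r e)) :
    LeavittFamily H (G.LeavittPathAlgebra K) where
  vert y := (gen K G).vert (i y)
  edge e := (gen K G).edge (τ e)
  ghost e := (gen K G).ghost (τ e)
  vert_mul_self y := (gen K G).vert_mul_self _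
  vert_mul_ne y z h := (gen K G).vert_mul_ne _ _ (hi.ne h)
  source_mul_edge e := by rw [← hs, (gen K G).source_mul_edge]
  edge_mul_range e := by rw [← hr, (gen K G).edge_mul_range]
  range_mul_ghost e := by rw [← hr, (gen K G).range_mul_ghost]
  ghost_mul_source e := by rw [← hs, (gen K G).ghost_mul_source]
  ghost_mul_self e := by rw [← hr, (gen K G).ghost_mul_self]
  ghost_mul_ne e f h := (gen K G).ghost_mul_ne _ _ (τ.injective.ne h)
  vert_eq_sum y h := by
    have hy : G.IsRegular (i y) := fun h' => h fun e he => h' (τ e) (by rw [hs, he])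
    rw [(gen K G).vert_eq_sum _ hy]
    refine (finsum_eq_of_bijective
      (τ.subtypeEquiv fun e => by rw [hs, hi.eq_iff] :
        {e // H.s e = y} ≃ {e // G.s e = i y}) (Equiv.bijective _) fun e => rfl).symm

/-- The inverse of an isomorphism of graphs. -/
def Iso.symm {G H : FinGraph.{u, v}} (φ : Iso G H) : Iso H G where
  onV := φ.onV.symm
  onE := φ.onE.symm
  s_comm e := by rw [Equiv.eq_symm_apply, ← φ.s_comm, Equiv.apply_symm_apply]
  r_comm e := by rw [Equiv.eq_symm_apply, ← φ.r_comm, Equiv.apply_symm_apply]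

variable (K) in
/-- The homomorphism of Leavitt path algebras given by an isomorphism of graphs. -/
noncomputable def Iso.leavittHom {G H : FinGraph.{u, v}} (φ : Iso G H) :
    G.LeavittPathAlgebra K →ₙₐ[K] H.LeavittPathAlgebra K :=
  (mapFamily φ.onV φ.onV.injective φ.onE φ.s_comm φ.r_comm).lift K

lemma Iso.leavittHom_comp_symm {G H : FinGraph.{u, v}} (φ : Iso G H) :
    (φ.leavittHom K).comp (φ.symm.leavittHom K) = NonUnitalAlgHom.id K _ := by
  apply hom_ext <;> intro a <;> simp [leavittHom, mapFamily, symm]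

lemma Iso.isFullCorner {G H : FinGraph.{u, v}} (φ : Iso G H) :
    IsFullCorner (φ.leavittHom K) :=
  .of_bijective (Function.bijective_iff_has_inverse.2 ⟨φ.symm.leavittHom K,
    fun a => DFunLike.congr_fun (φ.symm.leavittHom_comp_symm (K := K)) a,
    fun a => DFunLike.congr_fun (φ.leavittHom_comp_symm (K := K)) a⟩)

section Isolated

variable {G H : FinGraph.{u, v}} (σ : Option H.V ≃ G.V) (τ : H.E ≃ G.E)
  (hs : ∀ e, G.s (τ e) = σ (some (H.s e))) (hr : ∀ e, G.r (τ e) = σ (some (H.r e)))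

variable (K) in
/-- If `G` is the disjoint union of `H` and an isolated vertex `σ none`, the inclusion of the
Leavitt path algebra of `H` in that of `G`. -/
noncomputable def isolatedIncl : H.LeavittPathAlgebra K →ₙₐ[K] G.LeavittPathAlgebra K :=
  (mapFamily (fun y => σ (some y)) (σ.injective.comp (Option.some_injective _)) τ hs hr).lift K

lemma vert_mul_isolatedIncl (b : H.LeavittPathAlgebra K) :
    (gen K G).vert (σ none) * isolatedIncl K σ τ hs hr b = 0 := by
  have h : (gen K G).vert (σ none) * isolatedIncl K σ τ hs hr 1 = 0 := by
    have := Fintype.ofFinite H.V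
    rw [isolatedIncl, LeavittFamily.lift_one, finsum_eq_sum_of_fintype, Finset.mul_sum]
    exact Finset.sum_eq_zero fun y _ => (gen K G).vert_mul_ne _ _ (σ.injective.ne (by simp))
  rw [← one_mul b, map_mul, ← mul_assoc, h, zero_mul]

lemma isolatedIncl_mul_vert (b : H.LeavittPathAlgebra K) :
    isolatedIncl K σ τ hs hr b * (gen K G).vert (σ none) = 0 := by
  have h : isolatedIncl K σ τ hs hr 1 * (gen K G).vert (σ none) = 0 := by
    have := Fintype.ofFinite H.V
    rw [isolatedIncl, LeavittFamily.lift_one, finsum_eq_sum_of_fintype, Finset.sum_mul]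
    exact Finset.sum_eq_zero fun y _ => (gen K G).vert_mul_ne _ _ (σ.injective.ne (by simp))
  rw [← mul_one b, map_mul, mul_assoc, h, mul_zero]

variable (K) in
/-- If `G` is the disjoint union of `H` and an isolated vertex `σ none`, the homomorphism
`(c, b) ↦ c • σ none + b`. -/
noncomputable def isolatedHom : K × H.LeavittPathAlgebra K →ₙₐ[K] G.LeavittPathAlgebra K where
  toFun a := a.1 • (gen K G).vert (σ none) + isolatedIncl K σ τ hs hr a.2
  map_smul' c a := by simp [mul_smul]
  map_zero' := by simp
  map_add' a b := by simp only [Prod.fst_add, Prod.snd_add, add_smul, map_add]; abel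
  map_mul' a b := by
    simp only [Prod.fst_mul, Prod.snd_mul, add_mul, mul_add, map_mul, smul_smul, mul_comm b.1 a.1,
      (gen K G).vert_mul_self, smul_mul_assoc, mul_smul_comm, vert_mul_isolatedIncl,
      isolatedIncl_mul_vert, smul_zero, zero_add, add_zero]

lemma isolatedHom_apply (a : K × H.LeavittPathAlgebra K) : isolatedHom K σ τ hs hr a =
    a.1 • (gen K G).vert (σ none) + isolatedIncl K σ τ hs hr a.2 := rfl

/-- The images of the vertices of `G` in `K × L_K(H)`. -/
noncomputable def isolatedVert : Option H.V → K × H.LeavittPathAlgebra K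
  | none => (1, 0)
  | some y => (0, (gen K H).vert y)

variable (K) in
/-- The family that defines the inverse of `isolatedHom`. -/
noncomputable def isolatedFamily : LeavittFamily G (K × H.LeavittPathAlgebra K) where
  vert z := isolatedVert (σ.symm z)
  edge e := (0, (gen K H).edge (τ.symm e))
  ghost e := (0, (gen K H).ghost (τ.symm e))
  vert_mul_self z := by
    cases σ.symm z <;> simp [isolatedVert, (gen K H).vert_mul_self]
  vert_mul_ne y z h := by
    have h' := σ.symm.injective.ne h
    revert h'
    cases σ.symm y <;> cases σ.symm z <;> intro h' <;> simp [isolatedVert]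
    · exact absurd rfl h'
    · exact (gen K H).vert_mul_ne _ _ fun h => h' (congrArg some h)
  source_mul_edge e := by
    obtain ⟨e, rfl⟩ := τ.surjective e
    simp [hs, isolatedVert, (gen K H).source_mul_edge]
  edge_mul_range e := by
    obtain ⟨e, rfl⟩ := τ.surjective e
    simp [hr, isolatedVert, (gen K H).edge_mul_range]
  range_mul_ghost e := by
    obtain ⟨e, rfl⟩ := τ.surjective e
    simp [hr, isolatedVert, (gen K H).range_mul_ghost]
  ghost_mul_source e := by
    obtain ⟨e, rfl⟩ := τ.surjective e
    simp [hs, isolatedVert, (gen K H).ghost_mul_source]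
  ghost_mul_self e := by
    obtain ⟨e, rfl⟩ := τ.surjective e
    simp [hr, isolatedVert, (gen K H).ghost_mul_self]
  ghost_mul_ne e f h := by
    simp [(gen K H).ghost_mul_ne _ _ (τ.symm.injective.ne h)]
  vert_eq_sum z h := by
    obtain ⟨z, rfl⟩ := σ.surjective z
    cases z with
    | none =>
      refine absurd (fun e he => ?_) h
      obtain ⟨e, rfl⟩ := τ.surjective e
      rw [hs] at he
      simpa using σ.injective he
    | some y =>
      have hy : H.IsRegular y := fun h' => h fun e he => by
        obtain ⟨e, rfl⟩ := τ.surjective e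
        rw [hs] at he
        exact h' e (Option.some_injective _ (σ.injective he))
      rw [Equiv.symm_apply_apply, isolatedVert, (gen K H).vert_eq_sum y hy]
      have hinr (a : H.LeavittPathAlgebra K) : ((0 : K), a) = NonUnitalAlgHom.inr K K _ a := rfl
      rw [hinr, map_finsum_of_finite]
      refine finsum_eq_of_bijective
        (τ.subtypeEquiv fun e => by rw [hs, σ.injective.eq_iff, Option.some_inj] :
          {e // H.s e = y} ≃ {e // G.s e = σ (some y)}) (Equiv.bijective _) fun e => ?_
      simp

lemma isFullCorner_isolatedHom : IsFullCorner (isolatedHom K σ τ hs hr) := by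
  apply IsFullCorner.of_bijective
  let g := (isolatedFamily K σ τ hs hr).lift K
  have h1 : g.comp (isolatedIncl K σ τ hs hr) = NonUnitalAlgHom.inr K K _ := by
    apply hom_ext <;> intro a <;>
      simp [g, isolatedIncl, mapFamily, isolatedFamily, isolatedVert]
  have h2 : (isolatedHom K σ τ hs hr).comp g = NonUnitalAlgHom.id K _ := by
    apply hom_ext <;> intro a
    · obtain ⟨a, rfl⟩ := σ.surjective a
      cases a <;> simp [g, isolatedHom_apply, isolatedIncl, mapFamily, isolatedFamily, isolatedVert]
    · simp [g, isolatedHom_apply, isolatedIncl, mapFamily, isolatedFamily]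
    · simp [g, isolatedHom_apply, isolatedIncl, mapFamily, isolatedFamily]
  refine Function.bijective_iff_has_inverse.2 ⟨g, fun a => ?_, fun a => DFunLike.congr_fun h2 a⟩
  rw [isolatedHom_apply, map_add, map_smul]
  have h3 := DFunLike.congr_fun h1 a.2
  simp only [NonUnitalAlgHom.comp_apply] at h3
  rw [h3]
  simp [g, isolatedFamily, isolatedVert]

end Isolated

end FinGraph

/-! ### Block matrices and the edges of a collapse -/

namespace FinGraph

open LeavittPathAlgebra

section Block

variable {ι R : Type*} [Ring R]

/-- The matrix with entry `a` at `(none, none)`. -/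
def cornerBlock (a : R) : Matrix (Option ι) (Option ι) R :=
  .of fun i j => match i, j with
    | none, none => a
    | _, _ => 0

/-- The matrix with the entries of `b` in the row `none`. -/
def rowBlock (b : ι → R) : Matrix (Option ι) (Option ι) R :=
  .of fun i j => match i, j with
    | none, some j => b j
    | _, _ => 0

/-- The matrix with the entries of `c` in the column `none`. -/
def columnBlock (c : ι → R) : Matrix (Option ι) (Option ι) R :=
  .of fun i j => match i, j with
    | some i, none => c i
    | _, _ => 0

/-- The matrix with the entries of `d` on the diagonal away from `(none, none)`. -/
def diagonalBlock [DecidableEq ι] (d : ι → R) : Matrix (Option ι) (Option ι) R :=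
  .of fun i j => match i, j with
    | some i, some j => if i = j then d i else 0
    | _, _ => 0

section Mul

variable [Fintype ι] (a a' : R) (b b' c c' : ι → R)

lemma cornerBlock_mul_cornerBlock :
    (cornerBlock a : Matrix (Option ι) _ R) * cornerBlock a' = cornerBlock (a * a') := by
  ext (_ | i) (_ | j) <;> simp [cornerBlock, Matrix.mul_apply, Fintype.sum_option]

lemma cornerBlock_mul_rowBlock :
    cornerBlock a * rowBlock b = rowBlock fun j => a * b j := by
  ext (_ | i) (_ | j) <;> simp [cornerBlock, rowBlock, Matrix.mul_apply, Fintype.sum_option]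

lemma cornerBlock_mul_columnBlock : cornerBlock a * columnBlock c = 0 := by
  ext (_ | i) (_ | j) <;> simp [cornerBlock, columnBlock, Matrix.mul_apply, Fintype.sum_option]

lemma columnBlock_mul_cornerBlock :
    columnBlock c * cornerBlock a = columnBlock fun i => c i * a := by
  ext (_ | i) (_ | j) <;> simp [cornerBlock, columnBlock, Matrix.mul_apply, Fintype.sum_option]

lemma rowBlock_mul_cornerBlock : rowBlock b * cornerBlock a = 0 := by
  ext (_ | i) (_ | j) <;> simp [cornerBlock, rowBlock, Matrix.mul_apply, Fintype.sum_option]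

lemma rowBlock_mul_rowBlock : rowBlock b * rowBlock b' = 0 := by
  ext (_ | i) (_ | j) <;> simp [rowBlock, Matrix.mul_apply, Fintype.sum_option]

lemma columnBlock_mul_columnBlock : columnBlock c * columnBlock c' = 0 := by
  ext (_ | i) (_ | j) <;> simp [columnBlock, Matrix.mul_apply, Fintype.sum_option]

lemma rowBlock_mul_columnBlock :
    rowBlock b * columnBlock c = cornerBlock (∑ i, b i * c i) := by
  ext (_ | i) (_ | j) <;>
    simp [cornerBlock, rowBlock, columnBlock, Matrix.mul_apply, Fintype.sum_option]

lemma columnBlock_mul_rowBlock_eq_zero (h : ∀ i j, c i * b j = 0) :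
    columnBlock c * rowBlock b = 0 := by
  ext (_ | i) (_ | j) <;> simp [rowBlock, columnBlock, Matrix.mul_apply, Fintype.sum_option, h]

variable [DecidableEq ι] (d d' : ι → R)

lemma columnBlock_mul_rowBlock (h : ∀ i j, c i * b j = if i = j then d i else 0) :
    columnBlock c * rowBlock b = diagonalBlock d := by
  ext (_ | i) (_ | j) <;>
    simp [diagonalBlock, rowBlock, columnBlock, Matrix.mul_apply, Fintype.sum_option, h]

lemma rowBlock_mul_diagonalBlock :
    rowBlock b * diagonalBlock d = rowBlock fun j => b j * d j := by
  ext (_ | i) (_ | j) <;> simp [diagonalBlock, rowBlock, Matrix.mul_apply, Fintype.sum_option]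

lemma diagonalBlock_mul_columnBlock :
    diagonalBlock d * columnBlock c = columnBlock fun i => d i * c i := by
  ext (_ | i) (_ | j) <;> simp [diagonalBlock, columnBlock, Matrix.mul_apply, Fintype.sum_option]

lemma diagonalBlock_mul_diagonalBlock :
    diagonalBlock d * diagonalBlock d' = diagonalBlock fun i => d i * d' i := by
  ext (_ | i) (_ | j) <;> simp [diagonalBlock, Matrix.mul_apply, Fintype.sum_option]
  exact ite_congr rfl (fun h => by rw [h]) fun _ => rfl

lemma cornerBlock_mul_diagonalBlock : cornerBlock a * diagonalBlock d = 0 := by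
  ext (_ | i) (_ | j) <;> simp [cornerBlock, diagonalBlock, Matrix.mul_apply, Fintype.sum_option]

lemma diagonalBlock_mul_cornerBlock : diagonalBlock d * cornerBlock a = 0 := by
  ext (_ | i) (_ | j) <;> simp [cornerBlock, diagonalBlock, Matrix.mul_apply, Fintype.sum_option]

lemma sum_columnBlock_single_mul_rowBlock_single :
    ∑ k, columnBlock (Pi.single k (d k)) * rowBlock (Pi.single k (d' k)) =
      diagonalBlock fun k => d k * d' k := by
  ext (_ | i) (_ | j) <;>
    simp [rowBlock, columnBlock, diagonalBlock, Matrix.mul_apply, Fintype.sum_option,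
      Matrix.sum_apply, Pi.single_apply, eq_comm]
  exact ite_congr rfl (fun h => by rw [h]) fun _ => rfl

end Mul

variable (ι) in
/-- `cornerBlock` as a homomorphism of additive groups. -/
def cornerBlockHom : R →+ Matrix (Option ι) (Option ι) R where
  toFun := cornerBlock
  map_zero' := by ext (_ | i) (_ | j) <;> rfl
  map_add' a b := by ext (_ | i) (_ | j) <;> simp [cornerBlock]

lemma cornerBlockHom_apply (a : R) : cornerBlockHom ι a = cornerBlock a := rfl

end Block

lemma finsum_subtype_eq_sum_ite {α M : Type*} [Fintype α] [AddCommMonoid M] (p : α → Prop)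
    [DecidablePred p] (h : α → M) : ∑ᶠ a : {a // p a}, h a = ∑ a, if p a then h a else 0 := by
  rw [finsum_eq_sum_of_fintype, ← Finset.sum_filter]
  exact (Finset.sum_subtype _ (by simp) _).symm

section Collapse

variable {K : Type w} [Field K] {G : FinGraph.{u, v}} {x : G.V}

variable (G x) in
/-- The edges not touching `x`. -/
abbrev Avoiding : Type v := {e : G.E // G.s e ≠ x ∧ G.r e ≠ x}

variable (G x) in
/-- The edges with range `x`. -/
abbrev Incoming : Type v := {e : G.E // G.r e = x}

variable (G x) in
/-- The edges with source `x`. -/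
abbrev Outgoing : Type v := {e : G.E // G.s e = x}

lemma edge_cases {motive : G.E → Prop} (avoiding : ∀ e : Avoiding G x, motive e.1)
    (incoming : ∀ e : Incoming G x, motive e.1) (outgoing : ∀ e : Outgoing G x, motive e.1)
    (e : G.E) : motive e := by
  by_cases hs : G.s e = x
  · exact outgoing ⟨e, hs⟩
  · by_cases hr : G.r e = x
    · exact incoming ⟨e, hr⟩
    · exact avoiding ⟨e, hs, hr⟩

lemma finsum_edges_eq [Fintype (Avoiding G x)] [Fintype (Incoming G x)] [DecidableEq G.V]
    {M : Type*} [AddCommMonoid M] {y : G.V} (hy : y ≠ x) (h : G.E → M) :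
    ∑ᶠ e : {e // G.s e = y}, h e = (∑ a : Avoiding G x, if G.s a.1 = y then h a else 0) +
      ∑ i : Incoming G x, if G.s i.1 = y then h i else 0 := by
  have := Fintype.ofFinite G.E
  rw [finsum_subtype_eq_sum_ite, ← finsum_eq_sum_of_fintype (fun a : Avoiding G x => _),
    ← finsum_eq_sum_of_fintype (fun a : Incoming G x => _),
    finsum_subtype_eq_sum_ite _ fun e => if G.s e = y then h e else 0,
    finsum_subtype_eq_sum_ite _ fun e => if G.s e = y then h e else 0, ← Finset.sum_add_distrib]
  refine Finset.sum_congr rfl fun e _ => ?_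
  by_cases h1 : G.s e = y
  · by_cases h2 : G.r e = x <;> simp [h1, h2, hy]
  · simp [h1]

variable (hloop : ¬ G.IsBaseOfLoop x)

lemma finsum_collapse_edges_eq [Fintype (Avoiding G x)] [Fintype (Incoming G x)]
    [Fintype (Outgoing G x)] [DecidableEq G.V] {M : Type*} [AddCommMonoid M]
    (y : (G.collapse x hloop).V) (h : (G.collapse x hloop).E → M) :
    ∑ᶠ e : {e // (G.collapse x hloop).s e = y}, h e =
      (∑ a : Avoiding G x, if G.s a.1 = y.1 then h (.inl a) else 0) +
      ∑ i : Incoming G x, if G.s i.1 = y.1 then ∑ f : Outgoing G x, h (.inr (i, f)) else 0 := by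
  classical
  have h1 := finsum_subtype_eq_sum_ite (α := Avoiding G x ⊕ (Incoming G x × Outgoing G x))
    (fun e => (G.collapse x hloop).s e = y) h
  refine h1.trans ?_
  rw [Fintype.sum_sum_type, Fintype.sum_prod_type]
  congr 1
  · refine Finset.sum_congr rfl fun a _ => if_congr Subtype.ext_iff rfl rfl
  · refine Finset.sum_congr rfl fun i _ => ?_
    have (f : Outgoing G x) : (G.collapse x hloop).s (.inr (i, f)) = y ↔ G.s i.1 = y.1 :=
      Subtype.ext_iff
    simp only [this]
    split_ifs <;> simp

include hloop in
lemma Incoming.source_ne (e : Incoming G x) : G.s e.1 ≠ x := fun h => hloop ⟨e.1, h, e.2⟩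

include hloop in
lemma Outgoing.range_ne (e : Outgoing G x) : G.r e.1 ≠ x := fun h => hloop ⟨e.1, e.2, h⟩

lemma isRegular_of_collapse {y : (G.collapse x hloop).V} (h : (G.collapse x hloop).IsRegular y) :
    G.IsRegular y.1 := fun h' => h fun e he => by
  rcases e with e | ⟨e, f⟩
  · exact h' e.1 (congrArg Subtype.val he)
  · exact h' e.1 (congrArg Subtype.val he)

lemma IsRegular.collapse (hreg : G.IsRegular x) {y : (G.collapse x hloop).V}
    (h : G.IsRegular y.1) : (G.collapse x hloop).IsRegular y := fun h' => h fun e he => by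
  by_cases hr : G.r e = x
  · exact hreg fun f hf => h' (.inr (⟨e, hr⟩, ⟨f, hf⟩)) (Subtype.ext he)
  · exact h' (.inl ⟨e, he ▸ y.2, hr⟩) (Subtype.ext he)

section Family

variable {R : Type*} [Ring R] (P : LeavittFamily G R)

/-- The family of the collapse of `G` at `x` that a family of `G` gives rise to: the new edge
`[ef]` is represented by the product of `e` and `f`. -/
def LeavittFamily.collapse (hreg : G.IsRegular x) : LeavittFamily (G.collapse x hloop) R where
  vert y := P.vert y.1
  edge := Sum.elim (fun e => P.edge e.1) fun e => P.edge e.1.1 * P.edge e.2.1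
  ghost := Sum.elim (fun e => P.ghost e.1) fun e => P.ghost e.2.1 * P.ghost e.1.1
  vert_mul_self y := P.vert_mul_self y.1
  vert_mul_ne y z h := P.vert_mul_ne _ _ (Subtype.coe_ne_coe.2 h)
  source_mul_edge e := by
    rcases e with e | e
    · exact P.source_mul_edge e.1
    · change P.vert (G.s e.1.1) * (P.edge e.1.1 * P.edge e.2.1) = _
      rw [← mul_assoc, P.source_mul_edge]
      rfl
  edge_mul_range e := by
    rcases e with e | e
    · exact P.edge_mul_range e.1
    · change (P.edge e.1.1 * P.edge e.2.1) * P.vert (G.r e.2.1) = _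
      rw [mul_assoc, P.edge_mul_range]
      rfl
  range_mul_ghost e := by
    rcases e with e | e
    · exact P.range_mul_ghost e.1
    · change P.vert (G.r e.2.1) * (P.ghost e.2.1 * P.ghost e.1.1) = _
      rw [← mul_assoc, P.range_mul_ghost]
      rfl
  ghost_mul_source e := by
    rcases e with e | e
    · exact P.ghost_mul_source e.1
    · change (P.ghost e.2.1 * P.ghost e.1.1) * P.vert (G.s e.1.1) = _
      rw [mul_assoc, P.ghost_mul_source]
      rfl
  ghost_mul_self e := by
    rcases e with e | ⟨⟨e, he⟩, ⟨f, hf⟩⟩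
    · exact P.ghost_mul_self e.1
    · change (P.ghost f * P.ghost e) * (P.edge e * P.edge f) = P.vert (G.r f)
      rw [mul_assoc, ← mul_assoc (P.ghost e), P.ghost_mul_self, he, ← hf, P.source_mul_edge,
        P.ghost_mul_self]
  ghost_mul_ne e e' h := by
    rcases e with e | ⟨e, f⟩ <;> rcases e' with e' | ⟨e', f'⟩
    · exact P.ghost_mul_ne _ _ fun h' => h (congrArg Sum.inl (Subtype.ext h'))
    · change P.ghost e.1 * (P.edge e'.1 * P.edge f'.1) = 0
      rw [← mul_assoc, P.ghost_mul_ne, zero_mul]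
      intro h'
      exact e.2.2 (by rw [h', e'.2])
    · change (P.ghost f.1 * P.ghost e.1) * P.edge e'.1 = 0
      rw [mul_assoc, P.ghost_mul_ne, mul_zero]
      intro h'
      exact e'.2.2 (by rw [← h', e.2])
    · change (P.ghost f.1 * P.ghost e.1) * (P.edge e'.1 * P.edge f'.1) = 0
      rw [mul_assoc, ← mul_assoc (P.ghost e.1)]
      by_cases he : e = e'
      · subst he
        have hf : f.1 ≠ f'.1 := fun h' => h (by rw [Subtype.ext h'])
        rw [P.ghost_mul_self, e.2.trans f'.2.symm, P.source_mul_edge, P.ghost_mul_ne _ _ hf]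
      · rw [P.ghost_mul_ne _ _ (Subtype.coe_ne_coe.2 he), zero_mul, mul_zero]
  vert_eq_sum y hy := by
    classical
    have := Fintype.ofFinite (Avoiding G x)
    have := Fintype.ofFinite (Incoming G x)
    have := Fintype.ofFinite (Outgoing G x)
    refine Eq.trans ?_ (finsum_collapse_edges_eq hloop y fun e =>
      Sum.elim (fun e : Avoiding G x => P.edge e.1)
        (fun e : Incoming G x × Outgoing G x => P.edge e.1.1 * P.edge e.2.1) e *
      Sum.elim (fun e : Avoiding G x => P.ghost e.1)
        (fun e : Incoming G x × Outgoing G x => P.ghost e.2.1 * P.ghost e.1.1) e).symm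
    rw [P.vert_eq_sum y.1 (isRegular_of_collapse hloop hy),
      finsum_edges_eq y.2 fun e => P.edge e * P.ghost e]
    congr 1
    refine Finset.sum_congr rfl fun i _ => if_congr Iff.rfl ?_ rfl
    have hx : P.vert x = ∑ f : Outgoing G x, P.edge f.1 * P.ghost f.1 := by
      rw [P.vert_eq_sum x hreg, finsum_eq_sum_of_fintype]
    conv_lhs => rw [← P.edge_mul_range, i.2, hx, Finset.mul_sum, Finset.sum_mul]
    simp only [Sum.elim_inr, mul_assoc]

end Family

end Collapse

end FinGraph

/-! ### The matrix picture of a collapse -/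

namespace FinGraph

open LeavittPathAlgebra

section Expand

variable {G : FinGraph.{u, v}} {x : G.V} (hloop : ¬ G.IsBaseOfLoop x) {R : Type*} [Ring R]
  (Q : LeavittFamily (G.collapse x hloop) R)

/-- The range of an edge that `x` emits, as a vertex of the collapse. -/
def LeavittFamily.rangeVert (f : Outgoing G x) : R := Q.vert ⟨G.r f.1, f.range_ne hloop⟩

lemma rangeVert_mul_self (f : Outgoing G x) :
    Q.rangeVert hloop f * Q.rangeVert hloop f = Q.rangeVert hloop f :=
  Q.vert_mul_self _

open Classical in
/-- The image of a vertex `z` of `G` under `LeavittFamily.expand`. -/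
noncomputable def expandVert (z : G.V) : Matrix (Option (Outgoing G x)) (Option (Outgoing G x)) R :=
  if h : z = x then diagonalBlock (Q.rangeVert hloop) else cornerBlock (Q.vert ⟨z, h⟩)

open Classical in
/-- The image of an edge of `G` under `LeavittFamily.expand`. -/
noncomputable def expandEdge (e : G.E) : Matrix (Option (Outgoing G x)) (Option (Outgoing G x)) R :=
  if hs : G.s e = x then columnBlock (Pi.single ⟨e, hs⟩ (Q.rangeVert hloop ⟨e, hs⟩))
  else if hr : G.r e = x then rowBlock fun f => Q.edge (.inr (⟨e, hr⟩, f))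
  else cornerBlock (Q.edge (.inl ⟨e, hs, hr⟩))

open Classical in
/-- The image of a ghost edge of `G` under `LeavittFamily.expand`. -/
noncomputable def expandGhost (e : G.E) :
    Matrix (Option (Outgoing G x)) (Option (Outgoing G x)) R :=
  if hs : G.s e = x then rowBlock (Pi.single ⟨e, hs⟩ (Q.rangeVert hloop ⟨e, hs⟩))
  else if hr : G.r e = x then columnBlock fun f => Q.ghost (.inr (⟨e, hr⟩, f))
  else cornerBlock (Q.ghost (.inl ⟨e, hs, hr⟩))

open Classical in
lemma expandVert_of_eq {z : G.V} (hz : z = x) :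
    expandVert hloop Q z = diagonalBlock (Q.rangeVert hloop) :=
  dif_pos hz

lemma expandVert_of_ne {z : G.V} (h : z ≠ x) :
    expandVert hloop Q z = cornerBlock (Q.vert ⟨z, h⟩) :=
  dif_neg h

lemma expandEdge_avoiding (e : Avoiding G x) :
    expandEdge hloop Q e.1 = cornerBlock (Q.edge (.inl e)) := by
  rw [expandEdge, dif_neg e.2.1, dif_neg e.2.2]

lemma expandEdge_incoming (e : Incoming G x) :
    expandEdge hloop Q e.1 = rowBlock fun f => Q.edge (.inr (e, f)) := by
  rw [expandEdge, dif_neg (e.source_ne hloop), dif_pos e.2]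

open Classical in
lemma expandEdge_outgoing (e : Outgoing G x) :
    expandEdge hloop Q e.1 = columnBlock (Pi.single e (Q.rangeVert hloop e)) := by
  rw [expandEdge, dif_pos e.2]

lemma expandGhost_avoiding (e : Avoiding G x) :
    expandGhost hloop Q e.1 = cornerBlock (Q.ghost (.inl e)) := by
  rw [expandGhost, dif_neg e.2.1, dif_neg e.2.2]

lemma expandGhost_incoming (e : Incoming G x) :
    expandGhost hloop Q e.1 = columnBlock fun f => Q.ghost (.inr (e, f)) := by
  rw [expandGhost, dif_neg (e.source_ne hloop), dif_pos e.2]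

open Classical in
lemma expandGhost_outgoing (e : Outgoing G x) :
    expandGhost hloop Q e.1 = rowBlock (Pi.single e (Q.rangeVert hloop e)) := by
  rw [expandGhost, dif_pos e.2]

open Classical in
/-- A family of `G` in matrices over a ring with a family `Q` of the collapse of `G` at `x`. Rows
and columns are indexed by a symbol `none` and the edges `f` that `x` emits. With
`a none = 1 - x`, `a f = f`, `b none = 1 - x` and `b f = f*`, the image of `z` has the entries
`b i * z * a j`, written in terms of the collapse; for instance, an edge `e` with range `x` gives
the row of the `[ef]`. -/
noncomputable def LeavittFamily.expand [Fintype (Outgoing G x)] (hreg : G.IsRegular x) :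
    LeavittFamily G (Matrix (Option (Outgoing G x)) (Option (Outgoing G x)) R) where
  vert := expandVert hloop Q
  edge := expandEdge hloop Q
  ghost := expandGhost hloop Q
  vert_mul_self z := by
    by_cases h : z = x
    · rw [expandVert_of_eq _ _ h, diagonalBlock_mul_diagonalBlock]
      simp only [rangeVert_mul_self]
    · rw [expandVert_of_ne _ _ h, cornerBlock_mul_cornerBlock]
      exact congrArg cornerBlock (Q.vert_mul_self _)
  vert_mul_ne y z h := by
    by_cases hy : y = x
    · have hz : z ≠ x := fun hz => h (hy.trans hz.symm)
      rw [expandVert_of_eq _ _ hy, expandVert_of_ne _ _ hz, diagonalBlock_mul_cornerBlock]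
    · rw [expandVert_of_ne _ _ hy]
      by_cases hz : z = x
      · rw [expandVert_of_eq _ _ hz, cornerBlock_mul_diagonalBlock]
      · rw [expandVert_of_ne _ _ hz, cornerBlock_mul_cornerBlock, ← map_zero (cornerBlockHom _)]
        exact congrArg cornerBlock (Q.vert_mul_ne _ _ fun h' => h (congrArg Subtype.val h'))
  source_mul_edge e := by
    cases e using edge_cases (x := x) with
    | avoiding e =>
      rw [expandEdge_avoiding, expandVert_of_ne _ _ e.2.1, cornerBlock_mul_cornerBlock]
      exact congrArg cornerBlock (Q.source_mul_edge (.inl e))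
    | incoming e =>
      rw [expandEdge_incoming, expandVert_of_ne _ _ (e.source_ne hloop), cornerBlock_mul_rowBlock]
      exact congrArg rowBlock (funext fun f => Q.source_mul_edge (.inr (e, f)))
    | outgoing e =>
      rw [expandEdge_outgoing, expandVert_of_eq _ _ e.2, diagonalBlock_mul_columnBlock]
      refine congrArg columnBlock (funext fun f => ?_)
      by_cases h : f = e
      · rw [h, Pi.single_eq_same, rangeVert_mul_self]
      · rw [Pi.single_eq_of_ne h, mul_zero]
  edge_mul_range e := by
    cases e using edge_cases (x := x) with
    | avoiding e =>
      rw [expandEdge_avoiding, expandVert_of_ne _ _ e.2.2, cornerBlock_mul_cornerBlock]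
      exact congrArg cornerBlock (Q.edge_mul_range (.inl e))
    | incoming e =>
      rw [expandEdge_incoming, expandVert_of_eq _ _ e.2, rowBlock_mul_diagonalBlock]
      exact congrArg rowBlock (funext fun f => Q.edge_mul_range (.inr (e, f)))
    | outgoing e =>
      rw [expandEdge_outgoing, expandVert_of_ne _ _ (e.range_ne hloop),
        columnBlock_mul_cornerBlock]
      refine congrArg columnBlock (funext fun f => ?_)
      by_cases h : f = e
      · rw [h, Pi.single_eq_same]
        exact rangeVert_mul_self hloop Q e
      · rw [Pi.single_eq_of_ne h, zero_mul]
  range_mul_ghost e := by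
    cases e using edge_cases (x := x) with
    | avoiding e =>
      rw [expandGhost_avoiding, expandVert_of_ne _ _ e.2.2, cornerBlock_mul_cornerBlock]
      exact congrArg cornerBlock (Q.range_mul_ghost (.inl e))
    | incoming e =>
      rw [expandGhost_incoming, expandVert_of_eq _ _ e.2, diagonalBlock_mul_columnBlock]
      exact congrArg columnBlock (funext fun f => Q.range_mul_ghost (.inr (e, f)))
    | outgoing e =>
      rw [expandGhost_outgoing, expandVert_of_ne _ _ (e.range_ne hloop), cornerBlock_mul_rowBlock]
      refine congrArg rowBlock (funext fun f => ?_)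
      by_cases h : f = e
      · rw [h, Pi.single_eq_same]
        exact rangeVert_mul_self hloop Q e
      · rw [Pi.single_eq_of_ne h, mul_zero]
  ghost_mul_source e := by
    cases e using edge_cases (x := x) with
    | avoiding e =>
      rw [expandGhost_avoiding, expandVert_of_ne _ _ e.2.1, cornerBlock_mul_cornerBlock]
      exact congrArg cornerBlock (Q.ghost_mul_source (.inl e))
    | incoming e =>
      rw [expandGhost_incoming, expandVert_of_ne _ _ (e.source_ne hloop),
        columnBlock_mul_cornerBlock]
      exact congrArg columnBlock (funext fun f => Q.ghost_mul_source (.inr (e, f)))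
    | outgoing e =>
      rw [expandGhost_outgoing, expandVert_of_eq _ _ e.2, rowBlock_mul_diagonalBlock]
      refine congrArg rowBlock (funext fun f => ?_)
      by_cases h : f = e
      · rw [h, Pi.single_eq_same, rangeVert_mul_self]
      · rw [Pi.single_eq_of_ne h, zero_mul]
  ghost_mul_self e := by
    cases e using edge_cases (x := x) with
    | avoiding e =>
      rw [expandGhost_avoiding, expandEdge_avoiding, expandVert_of_ne _ _ e.2.2,
        cornerBlock_mul_cornerBlock]
      exact congrArg cornerBlock (Q.ghost_mul_self (.inl e))
    | incoming e =>
      rw [expandGhost_incoming, expandEdge_incoming, expandVert_of_eq _ _ e.2]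
      refine columnBlock_mul_rowBlock _ _ _ fun f g => ?_
      split_ifs with h
      · subst h
        exact Q.ghost_mul_self (.inr (e, f))
      · exact Q.ghost_mul_ne _ _ fun h' => h (congrArg Prod.snd (Sum.inr_injective h'))
    | outgoing e =>
      rw [expandGhost_outgoing, expandEdge_outgoing, expandVert_of_ne _ _ (e.range_ne hloop),
        rowBlock_mul_columnBlock, Finset.sum_eq_single e (fun f _ h => by
          rw [Pi.single_eq_of_ne h, zero_mul]) (by simp), Pi.single_eq_same, rangeVert_mul_self]
      rfl
  ghost_mul_ne e f h := by
    cases e using edge_cases (x := x) with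
    | avoiding e =>
      rw [expandGhost_avoiding]
      cases f using edge_cases (x := x) with
      | avoiding f =>
        rw [expandEdge_avoiding, cornerBlock_mul_cornerBlock, ← map_zero (cornerBlockHom _)]
        exact congrArg cornerBlock
          (Q.ghost_mul_ne _ _ fun h' => h (congrArg Subtype.val (Sum.inl_injective h')))
      | incoming f =>
        rw [expandEdge_incoming, cornerBlock_mul_rowBlock]
        have (g : Outgoing G x) : Q.ghost (.inl e) * Q.edge (.inr (f, g)) = 0 :=
          Q.ghost_mul_ne _ _ Sum.inl_ne_inr
        simp only [this]
        ext (_ | i) (_ | j) <;> rfl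
      | outgoing f => rw [expandEdge_outgoing, cornerBlock_mul_columnBlock]
    | incoming e =>
      rw [expandGhost_incoming]
      cases f using edge_cases (x := x) with
      | avoiding f =>
        rw [expandEdge_avoiding, columnBlock_mul_cornerBlock]
        have (g : Outgoing G x) : Q.ghost (.inr (e, g)) * Q.edge (.inl f) = 0 :=
          Q.ghost_mul_ne _ _ Sum.inr_ne_inl
        simp only [this]
        ext (_ | i) (_ | j) <;> rfl
      | incoming f =>
        rw [expandEdge_incoming]
        refine columnBlock_mul_rowBlock_eq_zero _ _ fun i j => Q.ghost_mul_ne _ _ fun h' => h ?_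
        exact congrArg (fun p => p.1.1) (Sum.inr_injective h')
      | outgoing f => rw [expandEdge_outgoing, columnBlock_mul_columnBlock]
    | outgoing e =>
      rw [expandGhost_outgoing]
      cases f using edge_cases (x := x) with
      | avoiding f => rw [expandEdge_avoiding, rowBlock_mul_cornerBlock]
      | incoming f => rw [expandEdge_incoming, rowBlock_mul_rowBlock]
      | outgoing f =>
        rw [expandEdge_outgoing, rowBlock_mul_columnBlock, ← map_zero (cornerBlockHom _)]
        refine congrArg cornerBlock (Finset.sum_eq_zero fun g _ => ?_)
        by_cases hg : g = e
        · rw [Pi.single_eq_of_ne (i := f) (fun h' => h (by rw [← hg, h'])), mul_zero]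
        · rw [Pi.single_eq_of_ne hg, zero_mul]
  vert_eq_sum z hz := by
    by_cases h : z = x
    · subst h
      rw [finsum_eq_sum_of_fintype, expandVert_of_eq _ _ rfl]
      have (e : Outgoing G z) := expandEdge_outgoing hloop Q e
      have (e : Outgoing G z) := expandGhost_outgoing hloop Q e
      simp only [*, sum_columnBlock_single_mul_rowBlock_single, rangeVert_mul_self]
    · have := Fintype.ofFinite (Avoiding G x)
      have := Fintype.ofFinite (Incoming G x)
      have hQ := (Q.vert_eq_sum ⟨z, h⟩ (IsRegular.collapse hloop hreg hz)).trans
        (finsum_collapse_edges_eq hloop ⟨z, h⟩ fun e => Q.edge e * Q.ghost e)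
      rw [finsum_edges_eq h fun e => expandEdge hloop Q e * expandGhost hloop Q e,
        expandVert_of_ne _ _ h, hQ]
      simp only [expandEdge_avoiding, expandGhost_avoiding, expandEdge_incoming,
        expandGhost_incoming, cornerBlock_mul_cornerBlock, rowBlock_mul_columnBlock]
      simp only [← cornerBlockHom_apply, map_add, map_sum, apply_ite (cornerBlockHom _), map_zero]

end Expand

section Main

variable {K : Type w} [Field K] {G : FinGraph.{u, v}} {x : G.V} (hloop : ¬ G.IsBaseOfLoop x)
  (hreg : G.IsRegular x)

variable (K) in
/-- The homomorphism from the Leavitt path algebra of the collapse of `G` at `x` to that of `G`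
with `[ef] ↦ e f`. It sends `1` to `1 - x`. -/
noncomputable def collapseHom :
    (G.collapse x hloop).LeavittPathAlgebra K →ₙₐ[K] G.LeavittPathAlgebra K :=
  ((gen K G).collapse hloop hreg).lift K

lemma collapseHom_one : collapseHom K hloop hreg 1 = 1 - (gen K G).vert x := by
  classical
  have := Fintype.ofFinite G.V
  rw [collapseHom, LeavittFamily.lift_one, ← sum_vert,
    finsum_eq_sum_of_fintype (gen K G).vert, eq_sub_iff_add_eq]
  change (∑ᶠ y : {y // y ≠ x}, (gen K G).vert y.1) + _ = _
  rw [finsum_subtype_eq_sum_ite, ← Finset.sum_filter, Finset.filter_ne', add_comm,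
    Finset.add_sum_erase _ _ (Finset.mem_univ x)]

lemma one_sub_vert_mul_vert {y : G.V} (hy : y ≠ x) :
    (1 - (gen K G).vert x) * (gen K G).vert y = (gen K G).vert y := by
  rw [sub_mul, one_mul, (gen K G).vert_mul_ne _ _ hy.symm, sub_zero]

open Classical in
/-- The corner at `(none, none)` of the matrix picture recovers the argument of `collapseHom`, which
is therefore injective. -/
lemma expand_collapseHom [Fintype (Outgoing G x)]
    (b : (G.collapse x hloop).LeavittPathAlgebra K) :
    ((gen K (G.collapse x hloop)).expand hloop hreg).lift K (collapseHom K hloop hreg b) =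
      cornerBlock b := by
  induction b using LeavittPathAlgebra.induction with
  | vert y =>
    rw [collapseHom, LeavittFamily.lift_vert]
    exact (LeavittFamily.lift_vert _ _).trans (expandVert_of_ne _ _ y.2)
  | edge e =>
    rw [collapseHom, LeavittFamily.lift_edge]
    rcases e with e | ⟨e, f⟩
    · exact (LeavittFamily.lift_edge _ _).trans (expandEdge_avoiding _ _ e)
    · change LeavittFamily.lift K _ ((gen K G).edge e.1 * (gen K G).edge f.1) = _
      rw [map_mul, LeavittFamily.lift_edge, LeavittFamily.lift_edge]
      change expandEdge _ _ _ * expandEdge _ _ _ = _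
      rw [expandEdge_incoming, expandEdge_outgoing, rowBlock_mul_columnBlock,
        Finset.sum_eq_single f (fun g _ h => by rw [Pi.single_eq_of_ne h, mul_zero]) (by simp),
        Pi.single_eq_same]
      exact congrArg cornerBlock ((gen K (G.collapse x hloop)).edge_mul_range (.inr (e, f)))
  | ghost e =>
    rw [collapseHom, LeavittFamily.lift_ghost]
    rcases e with e | ⟨e, f⟩
    · exact (LeavittFamily.lift_ghost _ _).trans (expandGhost_avoiding _ _ e)
    · change LeavittFamily.lift K _ ((gen K G).ghost f.1 * (gen K G).ghost e.1) = _
      rw [map_mul, LeavittFamily.lift_ghost, LeavittFamily.lift_ghost]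
      change expandGhost _ _ _ * expandGhost _ _ _ = _
      rw [expandGhost_incoming, expandGhost_outgoing, rowBlock_mul_columnBlock,
        Finset.sum_eq_single f (fun g _ h => by rw [Pi.single_eq_of_ne h, zero_mul]) (by simp),
        Pi.single_eq_same]
      exact congrArg cornerBlock ((gen K (G.collapse x hloop)).range_mul_ghost (.inr (e, f)))
  | zero => rw [map_zero, map_zero, ← cornerBlockHom_apply, map_zero]
  | add a b ha hb => rw [map_add, map_add, ha, hb]; exact (map_add (cornerBlockHom _) a b).symm
  | mul a b ha hb => rw [map_mul, map_mul, ha, hb, cornerBlock_mul_cornerBlock]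
  | smul c a ha =>
    rw [map_smul, map_smul, ha]
    ext (_ | i) (_ | j) <;> simp [cornerBlock]

end Main

end FinGraph

/-! ### Collapses give full corners -/

namespace FinGraph

open LeavittPathAlgebra

section Main

variable {K : Type w} [Field K] {G : FinGraph.{u, v}} {x : G.V} (hloop : ¬ G.IsBaseOfLoop x)
  (hreg : G.IsRegular x)

variable (K) in
/-- The elements `a i` with `∑ i, a i * b i = 1`, where the `b i` are given by `rowGen`: they are
`1 - x` and the edges that `x` emits. -/
noncomputable def colGen : Option (Outgoing G x) → G.LeavittPathAlgebra K
  | none => 1 - (gen K G).vert x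
  | some f => (gen K G).edge f.1

variable (K) in
/-- The elements `b i` with `∑ i, a i * b i = 1`, where the `a i` are given by `colGen`: they are
`1 - x` and the ghosts of the edges that `x` emits. -/
noncomputable def rowGen : Option (Outgoing G x) → G.LeavittPathAlgebra K
  | none => 1 - (gen K G).vert x
  | some f => (gen K G).ghost f.1

include hreg in
lemma sum_outgoing [Fintype (Outgoing G x)] :
    ∑ f : Outgoing G x, (gen K G).edge f.1 * (gen K G).ghost f.1 = (gen K G).vert x := by
  rw [(gen K G).vert_eq_sum x hreg, finsum_eq_sum_of_fintype]

include hreg in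
lemma sum_colGen_mul_rowGen [Fintype (Outgoing G x)] :
    ∑ i : Option (Outgoing G x), colGen K i * rowGen K i = 1 := by
  rw [Fintype.sum_option]
  simp only [colGen, rowGen, sum_outgoing hreg, mul_sub, sub_mul, one_mul, mul_one,
    (gen K G).vert_mul_self]
  abel

lemma rowGen_mul {i : Option (Outgoing G x)} {p : G.V} {u : G.LeavittPathAlgebra K}
    (hu : (gen K G).vert p * u = u) :
    (p ≠ x ∧ rowGen K i * u = u) ∨ rowGen K i * u = 0 ∨
      p = x ∧ ∃ f : Outgoing G x, rowGen K i * u = (gen K G).ghost f.1 * u := by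
  by_cases hp : p = x
  · subst hp
    cases i with
    | none => exact .inr (.inl (by rw [rowGen, sub_mul, hu, one_mul, sub_self]))
    | some f => exact .inr (.inr ⟨rfl, f, rfl⟩)
  · cases i with
    | none => exact .inl ⟨hp, by
        rw [rowGen, ← hu, ← mul_assoc, one_sub_vert_mul_vert hp]⟩
    | some f =>
      refine .inr (.inl ?_)
      rw [rowGen, ← hu, ← (gen K G).ghost_mul_source, mul_assoc, ← mul_assoc _ _ u,
        (gen K G).vert_mul_ne _ _ (fun h => hp (h.symm.trans f.2)), zero_mul, mul_zero]

lemma mul_colGen {j : Option (Outgoing G x)} {q : G.V} {u : G.LeavittPathAlgebra K}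
    (hu : u * (gen K G).vert q = u) :
    (q ≠ x ∧ u * colGen K j = u) ∨ u * colGen K j = 0 ∨
      q = x ∧ ∃ g : Outgoing G x, u * colGen K j = u * (gen K G).edge g.1 := by
  by_cases hq : q = x
  · subst hq
    cases j with
    | none => exact .inr (.inl (by rw [colGen, mul_sub, hu, mul_one, sub_self]))
    | some f => exact .inr (.inr ⟨rfl, f, rfl⟩)
  · cases j with
    | none => exact .inl ⟨hq, by
        rw [colGen, ← hu, mul_assoc, mul_sub, mul_one, (gen K G).vert_mul_ne _ _ hq, sub_zero]⟩
    | some f =>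
      refine .inr (.inl ?_)
      rw [colGen, ← hu, ← (gen K G).source_mul_edge, mul_assoc, ← mul_assoc _ _ ((gen K G).edge _),
        (gen K G).vert_mul_ne _ _ (fun h => hq (h.trans f.2)), zero_mul, mul_zero]

/-- If `u` runs from the vertex `p` to the vertex `q`, then the only entries `b i * u * a j` that
can be nonzero are `u`, `u g`, `f* u` or `f* u g`, according to whether `p` and `q` are `x`. -/
lemma rowGen_mul_colGen_mem {S : NonUnitalSubalgebra K (G.LeavittPathAlgebra K)} {p q : G.V}
    {u : G.LeavittPathAlgebra K} (hp : (gen K G).vert p * u = u) (hq : u * (gen K G).vert q = u)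
    (h1 : p ≠ x → q ≠ x → u ∈ S)
    (h2 : p ≠ x → q = x → ∀ g : Outgoing G x, u * (gen K G).edge g.1 ∈ S)
    (h3 : p = x → q ≠ x → ∀ f : Outgoing G x, (gen K G).ghost f.1 * u ∈ S)
    (h4 : p = x → q = x → ∀ f g : Outgoing G x,
      (gen K G).ghost f.1 * u * (gen K G).edge g.1 ∈ S)
    (i j : Option (Outgoing G x)) : rowGen K i * u * colGen K j ∈ S := by
  rcases rowGen_mul (i := i) hp with ⟨hpx, h⟩ | h | ⟨hpx, f, h⟩ <;> rw [h]
  · rcases mul_colGen (j := j) hq with ⟨hqx, h'⟩ | h' | ⟨hqx, g, h'⟩ <;> rw [h']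
    · exact h1 hpx hqx
    · exact zero_mem _
    · exact h2 hpx hqx g
  · rw [zero_mul]
    exact zero_mem _
  · rw [mul_assoc]
    rcases mul_colGen (j := j) hq with ⟨hqx, h'⟩ | h' | ⟨hqx, g, h'⟩ <;> rw [h']
    · exact h3 hpx hqx f
    · rw [mul_zero]
      exact zero_mem _
    · rw [← mul_assoc]
      exact h4 hpx hqx f g

/-- The elements `z` whose entries `b i * z * a j` all lie in the image of `collapseHom` form a
subalgebra, as `1 = ∑ k, a k * b k`; it contains the generators. -/
lemma rowGen_mul_mul_colGen_mem_range (z : G.LeavittPathAlgebra K)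
    (i j : Option (Outgoing G x)) :
    rowGen K i * z * colGen K j ∈ NonUnitalAlgHom.range (collapseHom K hloop hreg) := by
  have hvert (y : G.V) (hy : y ≠ x) :
      (gen K G).vert y ∈ NonUnitalAlgHom.range (collapseHom K hloop hreg) :=
    ⟨(gen K (G.collapse x hloop)).vert ⟨y, hy⟩, LeavittFamily.lift_vert _ _⟩
  have hedge (e : (G.collapse x hloop).E) : ((gen K G).collapse hloop hreg).edge e ∈
      NonUnitalAlgHom.range (collapseHom K hloop hreg) :=
    ⟨(gen K (G.collapse x hloop)).edge e, LeavittFamily.lift_edge _ _⟩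
  have hghost (e : (G.collapse x hloop).E) : ((gen K G).collapse hloop hreg).ghost e ∈
      NonUnitalAlgHom.range (collapseHom K hloop hreg) :=
    ⟨(gen K (G.collapse x hloop)).ghost e, LeavittFamily.lift_ghost _ _⟩
  have hfg (f g : Outgoing G x) : (gen K G).ghost f.1 * (gen K G).edge g.1 ∈
      NonUnitalAlgHom.range (collapseHom K hloop hreg) := by
    by_cases h : f = g
    · subst h
      rw [(gen K G).ghost_mul_self]
      exact hvert _ (f.range_ne hloop)
    · rw [(gen K G).ghost_mul_ne _ _ (Subtype.coe_ne_coe.2 h)]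
      exact zero_mem _
  induction z using LeavittPathAlgebra.induction generalizing i j with
  | vert y =>
    refine rowGen_mul_colGen_mem ((gen K G).vert_mul_self y) ((gen K G).vert_mul_self y)
      (fun h _ => hvert y h) (fun h h' => absurd h' h) (fun h h' => absurd h h')
      (fun h _ f g => ?_) i j
    rw [h.trans f.2.symm, (gen K G).ghost_mul_source]
    exact hfg f g
  | edge e =>
    refine rowGen_mul_colGen_mem ((gen K G).source_mul_edge e) ((gen K G).edge_mul_range e)
      (fun h h' => hedge (.inl ⟨e, h, h'⟩)) (fun _ h g => hedge (.inr (⟨e, h⟩, g)))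
      (fun h _ f => hfg f ⟨e, h⟩) (fun h h' => absurd ⟨e, h, h'⟩ hloop) i j
  | ghost e =>
    refine rowGen_mul_colGen_mem ((gen K G).range_mul_ghost e) ((gen K G).ghost_mul_source e)
      (fun h h' => hghost (.inl ⟨e, h', h⟩)) (fun _ h g => hfg ⟨e, h⟩ g)
      (fun h _ f => hghost (.inr (⟨e, h⟩, f))) (fun h h' => absurd ⟨e, h', h⟩ hloop) i j
  | zero => simp
  | add a b ha hb =>
    rw [mul_add, add_mul]
    exact add_mem (ha i j) (hb i j)
  | mul a b ha hb =>
    have := Fintype.ofFinite (Outgoing G x)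
    have h : rowGen K i * (a * b) * colGen K j =
        ∑ k : Option (Outgoing G x),
          (rowGen K i * a * colGen K k) * (rowGen K k * b * colGen K j) := by
      conv_lhs => rw [← mul_one a, ← sum_colGen_mul_rowGen hreg]
      simp only [Finset.mul_sum, Finset.sum_mul, mul_assoc]
    rw [h]
    exact sum_mem fun k _ => mul_mem (ha i k) (hb k j)
  | smul c a ha =>
    rw [mul_smul_comm, smul_mul_assoc]
    exact SMulMemClass.smul_mem c (ha i j)

lemma isFullCorner_collapseHom : IsFullCorner (collapseHom K hloop hreg) := by
  classical
  have := Fintype.ofFinite (Outgoing G x)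
  refine ⟨fun a b h => ?_, fun z hz => ?_, ?_⟩
  · have h' := congrArg (((gen K (G.collapse x hloop)).expand hloop hreg).lift K) h
    rw [expand_collapseHom, expand_collapseHom] at h'
    exact congrFun (congrFun h' none) none
  · rw [collapseHom_one] at hz
    rw [← hz]
    exact rowGen_mul_mul_colGen_mem_range hloop hreg z none none
  -- `1 = (1 - x) + ∑ f, f (1 - x) f*`, as the edges that `x` emits do not end at `x`.
  · refine IsFullCorner.exists_sum_of_fintype (ι := Option (Outgoing G x))
      (fun i => i.elim 1 fun f => (gen K G).edge f.1)
      (fun i => i.elim 1 fun f => (gen K G).ghost f.1) ?_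
    rw [Fintype.sum_option, collapseHom_one]
    have h (f : Outgoing G x) :
        (gen K G).edge f.1 * (1 - (gen K G).vert x) = (gen K G).edge f.1 := by
      rw [mul_sub, mul_one, ← (gen K G).edge_mul_range, mul_assoc,
        (gen K G).vert_mul_ne _ _ (f.range_ne hloop), mul_zero, sub_zero]
    simp only [Option.elim_none, Option.elim_some, h, sum_outgoing hreg, one_mul, mul_one,
      sub_add_cancel]

end Main

end FinGraph

/-! ### Successive eliminations and collapses -/

namespace FinGraph

open LeavittPathAlgebra

/-- The Leavitt path algebra of a graph obtained by collapses is a full corner of the original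
one. -/
lemma CollapsesTo.exists_isFullCorner (K : Type w) [Field K] {G F : FinGraph.{u, v}}
    (h : CollapsesTo G F) :
    ∃ f : F.LeavittPathAlgebra K →ₙₐ[K] G.LeavittPathAlgebra K, IsFullCorner f := by
  induction h with
  | of_iso φ => exact ⟨_, φ.symm.isFullCorner⟩
  | collapse x hreg hloop _ ih =>
    obtain ⟨f, hf⟩ := ih
    exact ⟨_, (isFullCorner_collapseHom hloop hreg).comp hf⟩

namespace Subgraph

variable {G : FinGraph.{u, v}} {H H' : G.Subgraph}

section Elim

variable {x : G.V} (hx : H.IsSource x) (hV : H'.verts = H.verts \ {x})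
  (hE : H'.edges = H.edges \ {e | G.s e = x})

include hx in
lemma IsSource.not_isBaseOfLoop : ¬ H.toGraph.IsBaseOfLoop ⟨x, hx.1⟩ :=
  fun ⟨e, _, he⟩ => hx.2 e.1 e.2 (congrArg Subtype.val he)

/-- Eliminating a source `x` is the same as collapsing the graph at it: there are no edges `e` with
range `x`, hence no new edges. -/
def sourceElimIso : Iso (H.toGraph.collapse ⟨x, hx.1⟩ hx.not_isBaseOfLoop) H'.toGraph where
  onV :=
    { toFun := fun y => ⟨y.1.1, hV ▸ ⟨y.1.2, fun h => y.2 (Subtype.ext h)⟩⟩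
      invFun := fun y => ⟨⟨y.1, (hV ▸ y.2 : y.1 ∈ H.verts \ {x}).1⟩, fun h =>
        (hV ▸ y.2 : y.1 ∈ H.verts \ {x}).2 (congrArg Subtype.val h)⟩
      left_inv := fun _ => rfl
      right_inv := fun _ => rfl }
  onE :=
    { toFun := Sum.elim
        (fun e => ⟨e.1.1, hE ▸ ⟨e.1.2, fun h => e.2.1 (Subtype.ext h)⟩⟩)
        (fun p => absurd (congrArg Subtype.val p.1.2) (hx.2 _ p.1.1.2))
      invFun := fun e => .inl ⟨⟨e.1, (hE ▸ e.2 : e.1 ∈ H.edges \ {e | G.s e = x}).1⟩,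
        fun h => (hE ▸ e.2 : e.1 ∈ H.edges \ {e | G.s e = x}).2 (congrArg Subtype.val h),
        fun h => hx.2 _ (hE ▸ e.2 : e.1 ∈ H.edges \ {e | G.s e = x}).1 (congrArg Subtype.val h)⟩
      left_inv := by
        rintro (e | p)
        · rfl
        · exact absurd (congrArg Subtype.val p.1.2) (hx.2 _ p.1.1.2)
      right_inv := fun _ => rfl }
  s_comm := by
    rintro (e | p)
    · rfl
    · exact absurd (congrArg Subtype.val p.1.2) (hx.2 _ p.1.1.2)
  r_comm := by
    rintro (e | p)
    · rfl
    · exact absurd (congrArg Subtype.val p.1.2) (hx.2 _ p.1.1.2)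

/-- The vertices after and before the elimination of `x`. -/
noncomputable def isolatedVertEquiv (hxH : x ∈ H.verts) : Option H'.toGraph.V ≃ H.toGraph.V :=
  Equiv.ofBijective
    (fun y => y.elim ⟨x, hxH⟩ fun y => ⟨y.1, (hV ▸ y.2 : y.1 ∈ H.verts \ {x}).1⟩) <| by
    have hne (y : H'.toGraph.V) : y.1 ≠ x := (hV ▸ y.2 : y.1 ∈ H.verts \ {x}).2
    refine ⟨?_, fun y => ?_⟩
    · rintro (_ | y) (_ | z) h
      · rfl
      · exact absurd (congrArg Subtype.val h).symm (hne z)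
      · exact absurd (congrArg Subtype.val h) (hne y)
      · have h' := congrArg (fun a : H.toGraph.V => a.1) h
        exact congrArg some (Subtype.ext h')
    · by_cases h : y.1 = x
      · exact ⟨none, Subtype.ext h.symm⟩
      · exact ⟨some ⟨y.1, hV ▸ ⟨y.2, h⟩⟩, rfl⟩

/-- Eliminating an isolated vertex does not change the edges. -/
def isolatedEdgeEquiv (hx0 : ∀ e ∈ H.edges, G.s e ≠ x) : H'.toGraph.E ≃ H.toGraph.E :=
  Equiv.subtypeEquivRight fun e => by
    rw [hE]
    exact ⟨fun h => h.1, fun h => ⟨h, hx0 e h⟩⟩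

end Elim

lemma SourceElim.verts_subset (h : SourceElim H H') : H'.verts ⊆ H.verts := by
  obtain ⟨x, -, hV, -⟩ := h
  rw [hV]
  exact Set.sdiff_subset

lemma verts_subset_of_reflTransGen (h : Relation.ReflTransGen SourceElim H H') :
    H'.verts ⊆ H.verts := by
  induction h with
  | refl => exact subset_rfl
  | tail _ h ih => exact h.verts_subset.trans ih

/-- Splitting off the first factor of `K ^ (k + 1)`. -/
def consHom (K A : Type*) [Field K] [Ring A] [Algebra K A] (k : ℕ) :
    (Fin (k + 1) → K) × A →ₙₐ[K] K × ((Fin k → K) × A) where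
  toFun a := (a.1 0, Fin.tail a.1, a.2)
  map_smul' _ _ := rfl
  map_zero' := rfl
  map_add' _ _ := rfl
  map_mul' _ _ := rfl

lemma isFullCorner_consHom (K A : Type*) [Field K] [Ring A] [Algebra K A] (k : ℕ) :
    IsFullCorner (consHom K A k) :=
  .of_bijective <| Function.bijective_iff_has_inverse.2
    ⟨fun a => (Fin.cons a.1 a.2.1, a.2.2), fun a => Prod.ext (Fin.cons_self_tail a.1) rfl,
      fun _ => rfl⟩

/-- Dropping the trivial factor `K ^ 0`. -/
def emptyHom (K A : Type*) [Field K] [Ring A] [Algebra K A] : (Fin 0 → K) × A →ₙₐ[K] A :=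
  NonUnitalAlgHom.snd K (Fin 0 → K) A

lemma isFullCorner_emptyHom (K A : Type*) [Field K] [Ring A] [Algebra K A] :
    IsFullCorner (emptyHom K A) :=
  .of_bijective ⟨fun _ _ h => Prod.ext (Subsingleton.elim _ _) h, fun a => ⟨(0, a), rfl⟩⟩

variable (K : Type w) [Field K]

/-- Induction along the elimination of sources. The hypothesis `hH`, that `H` contains all edges of
`G` with source in `H`, is inherited by all later graphs; it guarantees that a vertex of `H` is a
sink of `H` if and only if it is a sink of `G`. A source that is a sink of `G` is then isolated, and
contributes a factor `K`; any other one is removed by a collapse. -/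
lemma exists_isFullCorner_of_reflTransGen {H₀ : G.Subgraph}
    (h : Relation.ReflTransGen SourceElim H H₀) (hH : ∀ e, G.s e ∈ H.verts → e ∈ H.edges)
    (k : ℕ) (hk : {x | x ∈ H.verts ∧ G.IsSink x ∧ x ∉ H₀.verts}.ncard = k) :
    ∃ f : (Fin k → K) × H₀.toGraph.LeavittPathAlgebra K →ₙₐ[K] H.toGraph.LeavittPathAlgebra K,
      IsFullCorner f := by
  induction h using Relation.ReflTransGen.head_induction_on generalizing k with
  | refl =>
    have : {x | x ∈ H₀.verts ∧ G.IsSink x ∧ x ∉ H₀.verts} = ∅ :=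
      Set.eq_empty_of_forall_notMem fun x hx => hx.2.2 hx.1
    rw [this, Set.ncard_empty] at hk
    subst hk
    exact ⟨_, isFullCorner_emptyHom K _⟩
  | @head H H' hstep hrest ih =>
    have hsub := verts_subset_of_reflTransGen hrest
    obtain ⟨x, hx, hV, hE⟩ := hstep
    have hxH₀ : x ∉ H₀.verts := fun h => by
      have := hsub h
      rw [hV] at this
      exact this.2 rfl
    have hH' : ∀ e, G.s e ∈ H'.verts → e ∈ H'.edges := fun e he => by
      rw [hV] at he
      rw [hE]
      exact ⟨hH e he.1, he.2⟩
    by_cases hsink : G.IsSink x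
    · have hset : {y | y ∈ H.verts ∧ G.IsSink y ∧ y ∉ H₀.verts} =
          insert x {y | y ∈ H'.verts ∧ G.IsSink y ∧ y ∉ H₀.verts} := by
        ext y
        simp only [hV, Set.mem_ofPred_eq, Set.mem_insert_iff, Set.mem_sdiff, Set.mem_singleton_iff]
        constructor
        · rintro ⟨h1, h2⟩
          by_cases hy : y = x
          · exact .inl hy
          · exact .inr ⟨⟨h1, hy⟩, h2⟩
        · rintro (rfl | ⟨h1, h2⟩)
          · exact ⟨hx.1, hsink, hxH₀⟩
          · exact ⟨h1.1, h2⟩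
      rw [hset, Set.ncard_insert_of_notMem (fun h => by
        have := h.1
        rw [hV] at this
        exact this.2 rfl) (Set.toFinite _)] at hk
      subst hk
      obtain ⟨f, hf⟩ := ih hH' _ rfl
      exact ⟨_, (isFullCorner_isolatedHom (isolatedVertEquiv hV hx.1)
        (isolatedEdgeEquiv hE fun e _ => hsink e) (fun _ => rfl) (fun _ => rfl)).comp
        (hf.isFullCorner_idProd.comp (isFullCorner_consHom K _ _))⟩
    · have hset : {y | y ∈ H.verts ∧ G.IsSink y ∧ y ∉ H₀.verts} =
          {y | y ∈ H'.verts ∧ G.IsSink y ∧ y ∉ H₀.verts} := by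
        ext y
        simp only [hV, Set.mem_ofPred_eq, Set.mem_sdiff, Set.mem_singleton_iff]
        exact ⟨fun h => ⟨⟨h.1, fun hy => hsink (hy ▸ h.2.1)⟩, h.2⟩, fun h => ⟨h.1.1, h.2⟩⟩
      rw [hset] at hk
      obtain ⟨f, hf⟩ := ih hH' _ hk
      have hreg : H.toGraph.IsRegular ⟨x, hx.1⟩ := fun h => hsink fun e he =>
        h ⟨e, hH e (he ▸ hx.1)⟩ (Subtype.ext he)
      exact ⟨_, (isFullCorner_collapseHom hx.not_isBaseOfLoop hreg).comp
        ((sourceElimIso hx hV hE).symm.isFullCorner.comp hf)⟩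

end Subgraph

end FinGraph

/-- A graph is isomorphic to itself as a subgraph. -/
def FinGraph.wholeIso (G : FinGraph.{u, v}) : Iso (Subgraph.whole G).toGraph G where
  onV := Equiv.subtypeUnivEquiv fun _ => trivial
  onE := Equiv.subtypeUnivEquiv fun _ => trivial
  s_comm _ := rfl
  r_comm _ := rfl

theorem mainTheorem4 (K : Type w) [Field K] (E : FinGraph.{u, v})
    (Esf : E.Subgraph) (hEsf : Esf.IsSf)
    (k : ℕ) (hk : k = {x : E.V | E.IsSink x ∧ x ∉ Esf.verts}.ncard)
    (F : FinGraph.{u, v}) (hF : FinGraph.CollapsesTo Esf.toGraph F) (hFloop : F.IsTotallyLooped) :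
    IsMoritaEquivalent K (E.LeavittPathAlgebra K)
      ((Fin k → K) × F.LeavittPathAlgebra K) ∧
    ∃ (m : Fin k → ℕ) (n : ℕ) (p : Matrix (Fin n) (Fin n) (F.LeavittPathAlgebra K))
      (hp : IsFullIdempotent p),
      (∀ i, 0 < m i) ∧ 0 < n ∧
      Nonempty (E.LeavittPathAlgebra K ≃ₐ[K]
        (((i : Fin k) → Matrix (Fin (m i)) (Fin (m i)) K) × hp.1.Corner)) := by
  obtain ⟨f, hf⟩ := FinGraph.Subgraph.exists_isFullCorner_of_reflTransGen K hEsf.1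
    (fun _ _ => trivial) k (by rw [hk]; congr 1; ext x; exact and_iff_right trivial)
  obtain ⟨g, hg⟩ := hF.exists_isFullCorner K
  have h := E.wholeIso.isFullCorner.comp (hf.comp (hg.isFullCorner_idProd (C := Fin k → K)))
  exact ⟨h.isMoritaEquivalent, h.exists_algEquiv⟩
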